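/- Let $n\ge 1$, $\mathbb F=\mathbb Q(q,t)$ and $\mathbb K=\mathbb Q(q,t,a)$ with $q,t,a$ indeterminates, $x=(x_1,\dots,x_n)$, $\tau=(1,t^{-1},\dots,t^{1-n})$ and $\mathcal C_n=(\mathbb Z_{\ge 0})^n$. For $v\in\mathbb Z^n$ put $|v|=v_1+\cdots+v_n$ and $\overline v=(\overline v_1,\dots,\overline v_n)\in\mathbb F^n$, where $$\overline v_i=q^{v_i}t^{-k_i(v)},\qquad k_i(v)=\#\{k<i\mid v_k\ge v_i\}+\#\{k>i\mid v_k>v_i\}.$$ For $\alpha\in\mathcal C_n$ let $G_\alpha\in\mathbb F[x]$ be the non-symmetric interpolation Macdonald polynomial: the polynomial of degree at most $|\alpha|$ with $G_\alpha(\overline\beta)=0$ for all $\beta\in\mathcal C_n$ with $|\beta|\le|\alpha|$, $\beta\ne\alpha$, in which the coefficient of $x^\alpha$ is $1$. Put $K_\alpha(x)=G_\alpha(x)/G_\alpha(a\tau)\in\mathbb K[x]$. For $v\in\mathbb Z^n$ define $K_v\in\mathbb K(x)$ by $$K_v(x)=A_m(x;v)\,K_{v+(m^n)}(q^mx),\qquad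 A_m(x;v)=\prod_{i=1}^n\frac{(q^{1-m}a\overline v_i^{-1};q)_m}{(qt^{n-1}x_i;q)_m},$$ where $m\in\mathbb Z_{\ge0}$ is such that $v+(m^n)\in\mathcal C_n$ (with $(m^n)=(m,\dots,m)$), and $(y;q)_m=\prod_{j=0}^{m-1}(1-q^jy)$. Let $\mathcal F$ be the space of $\mathbb K(x)$-valued functions on $\mathbb Z^n$ and $K\in\mathcal F$ the function $v\mapsto K_v$. The symmetric group acts on $\mathbb K(x)$ by permuting variables, $s_i$ interchanging $x_i$ and $x_{i+1}$, and on $\mathbb Z^n$ by permuting entries. On $\mathbb K(x)$ consider the $\mathbb K$-linear operators $$H_i=t+\frac{x_i-tx_{i+1}}{x_i-x_{i+1}}(s_i-1)\ (1\le i<n),\qquad \Delta f(x_1,\dots,x_n)=f(q^{-1}x_n,x_1,\dots,x_{n-1}),$$ $$\Phi=(x_n-t^{1-n})\Delta,\qquad \Xi_j=\frac1{x_j}+\frac1{x_j}H_j\cdots H_{n-1}\,\Phi\, H_1\cdots H_{j-1}\ (1\le j\le n),$$ acting on $\mathcal F$ through the values of functions. On $\mathcal F$ consider also the $\mathbb K(x)$-linear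 operators $$(\widehat H_if)(v)=tf(v)+\frac{\overline v_i-t\overline v_{i+1}}{\overline v_i-\overline v_{i+1}}\bigl(f(s_iv)-f(v)\bigr),\qquad (\widehat x_jf)(v)=a\overline v_jf(v),$$ $$(\widehat\Delta f)(v)=f(v_n-1,v_1,\dots,v_{n-1}),\qquad(\widehat\Delta^{-1}f)(v)=f(v_2,\dots,v_n,v_1+1).$$ Then the following hold. For every $\alpha\in\mathcal C_n$ the polynomial $G_\alpha$ exists and is unique, and $G_\alpha(a\tau)\neq0$; $K_v$ does not depend on the choice of $m$, and it agrees with the polynomial $K_\alpha$ when $v=\alpha\in\mathcal C_n$. Moreover, as identities in $\mathcal F$, 1. $H_iK=\widehat H_iK$ for $1\le i<n$; 2. $\Xi_jK=a\,\widehat x_j^{-1}K$ for $1\le j\le n$; 3. $\Phi K=t^{1-n}(a^2\widehat x_1^{-1}-1)\widehat\Delta^{-1}K$. -/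

import Mathlib

namespace InterpolationMacdonald

noncomputable section

/-! ### Fields

Throughout, the number of variables is `n + 1` with `n : ℕ`, so that indices `1, …, N` of the
mathematical notation (`N = n + 1 ≥ 1`) correspond to `0, …, n`, that is, to `Fin (n + 1)`.
The exponent `1 - N` is therefore `-n`. -/

/-- The field `𝔽 = ℚ(q, t)`. -/
abbrev FF : Type := FractionRing (MvPolynomial (Fin 2) ℚ)

/-- The field `𝕂 = ℚ(q, t, a) = 𝔽(a)`. -/
abbrev KK : Type := RatFunc FF

/-- The indeterminate `q` in `𝔽`. -/
def qF : FF := algebraMap (MvPolynomial (Fin 2) ℚ) FF (MvPolynomial.X 0)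

/-- The indeterminate `t` in `𝔽`. -/
def tF : FF := algebraMap (MvPolynomial (Fin 2) ℚ) FF (MvPolynomial.X 1)

/-- The indeterminate `q` in `𝕂`. -/
def qK : KK := algebraMap FF KK qF

/-- The indeterminate `t` in `𝕂`. -/
def tK : KK := algebraMap FF KK tF

/-- The indeterminate `a` in `𝕂`. -/
def aK : KK := RatFunc.X

lemma qF_ne_zero : qF ≠ 0 := by
  simp [qF, MvPolynomial.X_ne_zero]

lemma tF_ne_zero : tF ≠ 0 := by
  simp [tF, MvPolynomial.X_ne_zero]

lemma qK_ne_zero : qK ≠ 0 := by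
  simpa [qK] using qF_ne_zero

lemma aK_ne_zero : aK ≠ 0 := RatFunc.X_ne_zero

/-- The polynomial ring `𝕂[x]` in `n + 1` variables. -/
abbrev KPoly (n : ℕ) : Type := MvPolynomial (Fin (n + 1)) KK

/-- The field of rational functions `𝕂(x)` in `n + 1` variables. -/
abbrev KRat (n : ℕ) : Type := FractionRing (KPoly n)

/-- The variable `x_j` in `𝕂(x)`. -/
def xvar (n : ℕ) (j : Fin (n + 1)) : KRat n := algebraMap (KPoly n) (KRat n) (MvPolynomial.X j)

/-! ### Spectral points -/

/-- `k_i(v) = #{k < i | v_k ≥ v_i} + #{k > i | v_k > v_i}`. -/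
def kIndex {n : ℕ} (v : Fin (n + 1) → ℤ) (i : Fin (n + 1)) : ℕ :=
  (Finset.univ.filter fun k => k < i ∧ v i ≤ v k).card +
    (Finset.univ.filter fun k => i < k ∧ v i < v k).card

/-- The spectral point `v̄ ∈ 𝔽ⁿ⁺¹` with coordinates `q ^ (v_i) * t ^ (-k_i(v))`. -/
def barF {n : ℕ} (v : Fin (n + 1) → ℤ) (i : Fin (n + 1)) : FF :=
  qF ^ (v i) * tF ^ (-(kIndex v i : ℤ))

/-- The spectral point `v̄` with coordinates regarded in `𝕂`. -/
def barK {n : ℕ} (v : Fin (n + 1) → ℤ) (i : Fin (n + 1)) : KK :=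
  algebraMap FF KK (barF v i)

lemma barF_ne_zero {n : ℕ} (v : Fin (n + 1) → ℤ) (i : Fin (n + 1)) : barF v i ≠ 0 :=
  mul_ne_zero (zpow_ne_zero _ qF_ne_zero) (zpow_ne_zero _ tF_ne_zero)

lemma barK_ne_zero {n : ℕ} (v : Fin (n + 1) → ℤ) (i : Fin (n + 1)) : barK v i ≠ 0 := by
  simpa [barK] using barF_ne_zero v i

/-- The point `aτ` with `τ_i = t ^ (1 - i)` (`1`-based `i`). -/
def aTau (n : ℕ) (i : Fin (n + 1)) : KK := aK * tK ^ (-(i : ℤ))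

/-! ### Interpolation polynomials -/

/-- `G` is the non-symmetric interpolation Macdonald polynomial of degree `α`: it has degree at
most `|α|`, vanishes at `β̄` for all compositions `β ≠ α` with `|β| ≤ |α|`, and the coefficient
of `x ^ α` in `G` is `1`. -/
structure IsInterpolation {n : ℕ} (α : Fin (n + 1) → ℕ) (G : MvPolynomial (Fin (n + 1)) FF) :
    Prop where
  degree_le : G.totalDegree ≤ ∑ i, α i
  vanishing : ∀ β : Fin (n + 1) → ℕ, ∑ i, β i ≤ ∑ i, α i → β ≠ α →
    MvPolynomial.eval (barF fun i => (β i : ℤ)) G = 0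
  coeff_eq_one : MvPolynomial.coeff (Finsupp.equivFunOnFinite.symm α) G = 1

/-- The non-symmetric interpolation Macdonald polynomial `G_α ∈ 𝔽[x]`. -/
def interpG {n : ℕ} (α : Fin (n + 1) → ℕ) : MvPolynomial (Fin (n + 1)) FF :=
  Classical.epsilon (IsInterpolation α)

/-- `G_α` regarded as an element of `𝕂[x]`. -/
def interpGK {n : ℕ} (α : Fin (n + 1) → ℕ) : KPoly n :=
  MvPolynomial.map (algebraMap FF KK) (interpG α)

/-- The evaluation `G_α(aτ) ∈ 𝕂`. -/
def evalG {n : ℕ} (α : Fin (n + 1) → ℕ) : KK :=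
  MvPolynomial.eval (aTau n) (interpGK α)

/-- The normalized polynomial `K_α = G_α / G_α(aτ) ∈ 𝕂[x]`. -/
def Kpoly {n : ℕ} (α : Fin (n + 1) → ℕ) : KPoly n :=
  MvPolynomial.C (evalG α)⁻¹ * interpGK α

/-! ### Extension to all integral vectors -/

/-- The `q`-shifted factorial `(y; q)_m = ∏_{j < m} (1 - q ^ j y)` in `𝕂(x)`. -/
def qPoch {n : ℕ} (y : KRat n) (m : ℕ) : KRat n :=
  ∏ j ∈ Finset.range m, (1 - algebraMap KK (KRat n) (qK ^ j) * y)

/-- The factor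
`A_m(x; v) = ∏_i (q ^ (1 - m) a v̄_i⁻¹; q)_m / (q t ^ (N - 1) x_i; q)_m`, where `N = n + 1`. -/
def factorA {n : ℕ} (m : ℕ) (v : Fin (n + 1) → ℤ) : KRat n :=
  ∏ i, qPoch (algebraMap KK (KRat n) (qK ^ (1 - (m : ℤ)) * aK * (barK v i)⁻¹)) m /
    qPoch (algebraMap KK (KRat n) (qK * tK ^ n) * xvar n i) m

/-- The rational function `A_m(x; v) K_{v + (m, …, m)}(q ^ m x)`; it is meant for those `m` for
which all entries of `v + (m, …, m)` are nonnegative. -/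
def shiftedK {n : ℕ} (m : ℕ) (v : Fin (n + 1) → ℤ) : KRat n :=
  factorA m v *
    MvPolynomial.aeval (fun i => algebraMap KK (KRat n) (qK ^ m) * xvar n i)
      (Kpoly fun i => (v i + m).toNat)

/-- The least `m : ℕ` for which all entries of `v + (m, …, m)` are nonnegative. -/
def minShift {n : ℕ} (v : Fin (n + 1) → ℤ) : ℕ :=
  Finset.univ.sup fun i => (-v i).toNat

/-- The space of `𝕂(x)`-valued functions on `ℤⁿ⁺¹`. -/
abbrev FunSpace (n : ℕ) : Type := (Fin (n + 1) → ℤ) → KRat n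

/-- The map `K : v ↦ K_v ∈ 𝕂(x)` on all integral vectors. -/
def Kext (n : ℕ) : FunSpace n := fun v => shiftedK (minShift v) v

/-! ### Operators on rational functions -/

/-- The automorphism of `𝕂(x)` interchanging `x_i` and `x_{i+1}`. -/
def swapVars (n : ℕ) (i : Fin n) : KRat n ≃ₐ[KK] KRat n :=
  IsFractionRing.fieldEquivOfAlgEquiv KK (KRat n) (KRat n)
    (MvPolynomial.renameEquiv KK (Equiv.swap i.castSucc i.succ))

/-- The automorphism `f(x_1, …, x_N) ↦ f(q⁻¹ x_N, x_1, …, x_{N-1})` of `𝕂[x]`. -/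
def deltaPoly (n : ℕ) : KPoly n ≃ₐ[KK] KPoly n :=
  AlgEquiv.ofAlgHom
    (MvPolynomial.aeval (Fin.cons (MvPolynomial.C qK⁻¹ * MvPolynomial.X (Fin.last n))
      fun i : Fin n => MvPolynomial.X i.castSucc))
    (MvPolynomial.aeval (Fin.snoc (fun i : Fin n => MvPolynomial.X i.succ)
      (MvPolynomial.C qK * MvPolynomial.X 0)))
    (by
      ext1 i
      refine Fin.lastCases ?_ (fun i => ?_) i
      · simp [← mul_assoc, ← MvPolynomial.C_mul, MvPolynomial.algebraMap_eq, qK_ne_zero]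
      · simp)
    (by
      ext1 i
      refine Fin.cases ?_ (fun i => ?_) i
      · simp [← mul_assoc, ← MvPolynomial.C_mul, MvPolynomial.algebraMap_eq, qK_ne_zero]
      · simp)

/-- The automorphism `Δ f(x_1, …, x_N) = f(q⁻¹ x_N, x_1, …, x_{N-1})` of `𝕂(x)`. -/
def Delta (n : ℕ) : KRat n ≃ₐ[KK] KRat n :=
  IsFractionRing.fieldEquivOfAlgEquiv KK (KRat n) (KRat n) (deltaPoly n)

/-- Multiplication by a rational function, as an operator on `𝕂(x)`. -/
def mulOp {n : ℕ} (g : KRat n) : Module.End KK (KRat n) := LinearMap.mulLeft KK g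

/-- The Demazure-Lusztig operator
`H_i = t + (x_i - t x_{i+1}) / (x_i - x_{i+1}) * (s_i - 1)` on `𝕂(x)`. -/
def HOp (n : ℕ) (i : Fin n) : Module.End KK (KRat n) :=
  tK • 1 +
    mulOp ((xvar n i.castSucc - algebraMap KK (KRat n) tK * xvar n i.succ) /
        (xvar n i.castSucc - xvar n i.succ)) *
      ((swapVars n i).toLinearMap - 1)

/-- The operator `Φ = (x_N - t ^ (1 - N)) Δ`, where `N = n + 1`. -/
def PhiOp (n : ℕ) : Module.End KK (KRat n) :=
  mulOp (xvar n (Fin.last n) - algebraMap KK (KRat n) (tK ^ (-(n : ℤ)))) *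
    (Delta n).toLinearMap

/-- The product `H_j H_{j+1} ⋯ H_{N-1}`. -/
def HFrom (n : ℕ) (j : Fin (n + 1)) : Module.End KK (KRat n) :=
  (((List.finRange n).filter fun i => j ≤ i.castSucc).map (HOp n)).prod

/-- The product `H_1 H_2 ⋯ H_{j-1}`. -/
def HUpTo (n : ℕ) (j : Fin (n + 1)) : Module.End KK (KRat n) :=
  (((List.finRange n).filter fun i => i.castSucc < j).map (HOp n)).prod

/-- The inhomogeneous Cherednik operator
`Ξ_j = x_j⁻¹ + x_j⁻¹ H_j ⋯ H_{N-1} Φ H_1 ⋯ H_{j-1}`. -/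
def XiOp (n : ℕ) (j : Fin (n + 1)) : Module.End KK (KRat n) :=
  mulOp (xvar n j)⁻¹ + mulOp (xvar n j)⁻¹ * (HFrom n j * PhiOp n * HUpTo n j)

/-- An operator on `𝕂(x)` acts on `𝕂(x)`-valued functions on `ℤⁿ⁺¹` by acting on the values. -/
def onValues {n : ℕ} (T : Module.End KK (KRat n)) : Module.End KK (FunSpace n) :=
  LinearMap.compLeft T (Fin (n + 1) → ℤ)

/-! ### Operators acting on the degree variable -/

/-- The action of `s_i` on integral vectors, interchanging the entries `v_i` and `v_{i+1}`. -/
def swapEntries {n : ℕ} (i : Fin n) (v : Fin (n + 1) → ℤ) : Fin (n + 1) → ℤ :=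
  v ∘ Equiv.swap i.castSucc i.succ

/-- `v^♮ = (v_2, …, v_N, v_1 + 1)`. -/
def natVec {n : ℕ} (v : Fin (n + 1) → ℤ) : Fin (n + 1) → ℤ :=
  Fin.snoc (Fin.tail v) (v 0 + 1)

/-- `v^♯ = (v_N - 1, v_1, …, v_{N-1})`. -/
def sharpVec {n : ℕ} (v : Fin (n + 1) → ℤ) : Fin (n + 1) → ℤ :=
  Fin.cons (v (Fin.last n) - 1) (Fin.init v)

lemma sharpVec_natVec {n : ℕ} (v : Fin (n + 1) → ℤ) : sharpVec (natVec v) = v := by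
  simp [sharpVec, natVec]

lemma natVec_sharpVec {n : ℕ} (v : Fin (n + 1) → ℤ) : natVec (sharpVec v) = v := by
  simp [sharpVec, natVec]

/-- `(Ĥ_i f)(v) = t f(v) + (v̄_i - t v̄_{i+1}) / (v̄_i - v̄_{i+1}) * (f(s_i v) - f(v))`. -/
def hatH (n : ℕ) (i : Fin n) : Module.End (KRat n) (FunSpace n) where
  toFun f v := tK • f v +
    ((barK v i.castSucc - tK * barK v i.succ) / (barK v i.castSucc - barK v i.succ)) •
      (f (swapEntries i v) - f v)
  map_add' f g := by
    funext v
    simp only [Pi.add_apply, Algebra.smul_def]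
    ring
  map_smul' c f := by
    funext v
    simp only [Pi.smul_apply, smul_eq_mul, Algebra.smul_def, RingHom.id_apply]
    ring

/-- `(Δ̂ f)(v) = f(v^♯)`, with inverse `(Δ̂⁻¹ f)(v) = f(v^♮)`. -/
def hatDelta (n : ℕ) : FunSpace n ≃ₗ[KRat n] FunSpace n where
  toFun f v := f (sharpVec v)
  invFun f v := f (natVec v)
  map_add' _ _ := rfl
  map_smul' _ _ := rfl
  left_inv f := by funext v; simp [sharpVec_natVec]
  right_inv f := by funext v; simp [natVec_sharpVec]

/-- `(x̂_j f)(v) = a v̄_j f(v)`, an invertible operator. -/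
def hatX (n : ℕ) (j : Fin (n + 1)) : FunSpace n ≃ₗ[KRat n] FunSpace n where
  toFun f v := (aK * barK v j) • f v
  invFun f v := (aK * barK v j)⁻¹ • f v
  map_add' f g := by funext v; simp
  map_smul' c f := by funext v; simp
  left_inv f := by
    funext v
    exact inv_smul_smul₀ (mul_ne_zero aK_ne_zero (barK_ne_zero v j)) (f v)
  right_inv f := by
    funext v
    exact smul_inv_smul₀ (mul_ne_zero aK_ne_zero (barK_ne_zero v j)) (f v)

end

end InterpolationMacdonald

open InterpolationMacdonald

/-! Let N = n + 1 be the number of variables. A polynomial has type v (`HasType`) if its degree is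
at most |v| and it vanishes at w̄ for every composition w ≠ v with |w| ≤ |v|. Polynomials of a given
type are unique up to a scalar. Hence an operator carrying type v to type v' sends K_v to a multiple
of K_{v'}, and the multiple is its value at aτ, where every K_{v'} equals 1.

Unisolvence (`eq_zero_of_vanishing`): the points of the compositions (w, 0) lie on the hyperplane
x_N = t^(1-N), and there they are the spectral points in N - 1 variables. By induction on N, a
polynomial vanishing at all points of weight at most d is zero on this hyperplane, hence divisible
by x_N - t^(1-N). The other compositions are the v^♮, with spectral point (v̄_2, …, v̄_N, q v̄_1);
undoing this rotation in the quotient lowers d. The same descent, following the coefficient of x^α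
(`HasType.eq_zero_of_coeff`), shows that the square linear system defining G_α is injective, hence
solvable.

Operators: the value of H_i p at v̄ involves only the values of p at v̄ and at the spectral point of
s_i v, so H_i p minus a multiple of p has type s_i v; and Φ carries type v to type v^♮. Since (aτ)_i
= t (aτ)_{i+1}, evaluation at aτ turns H_i into t. For Φ the value at aτ comes from the Cherednik
operators. At x_j = 0 the operator H_j ⋯ Φ ⋯ H_{j-1} acts as -1, so Ξ_j p is a polynomial, and its
values at spectral points show that Ξ_j p = v̄_j⁻¹ p (`HasType.cherednik_apply`). Evaluating the
case j = 1 at aτ gives (Φ p)(aτ). The same formulas show G_α(aτ) ≠ 0, as type α is reached from the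
constant 1 by steps with nonzero factors.

General v: Φ^N relates K_{v+(1^N)}(qx) to K_v(x), which gives independence of m. The operator f ↦
f(q^m x) / ∏ (q t^(N-1) x_i; q)_m (`shiftOp`) commutes with H_i and Φ, and with Ξ_j up to q^m, so
the identities pass from compositions to all of ℤ^N once the scalars in the numerator of A_m are
compared. -/

namespace InterpolationMacdonald

noncomputable section

variable {k : Type*} [Field k]

/-! ### Spectral points over a general field -/

/-- The index `k_i(v)`, for vectors of arbitrary length, as a single count. -/
def rankIdx {n : ℕ} (v : Fin n → ℤ) (i : Fin n) : ℕ :=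
  ∑ k, if (k < i ∧ v i ≤ v k) ∨ (i < k ∧ v i < v k) then 1 else 0

lemma kIndex_eq_rankIdx {n : ℕ} (v : Fin (n + 1) → ℤ) (i : Fin (n + 1)) :
    kIndex v i = rankIdx v i := by
  rw [kIndex, rankIdx, ← Finset.card_filter, Finset.filter_or, Finset.card_union_of_disjoint]
  rw [Finset.disjoint_filter]
  intro k _ h1 h2
  exact lt_asymm h1.1 h2.1

/-- The first entry moves to the end and grows by one. For integers the old condition v_1 ≥ v_i is
the new strict condition v_1 + 1 > v_i, so no count changes. -/
lemma rankIdx_natVec_castSucc {n : ℕ} (v : Fin (n + 1) → ℤ) (i : Fin n) :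
    rankIdx (natVec v) i.castSucc = rankIdx v i.succ := by
  rw [rankIdx, rankIdx, Fin.sum_univ_castSucc, Fin.sum_univ_succ, add_comm]
  simp [natVec, Fin.tail, Fin.castSucc_lt_last, (Fin.castSucc_lt_last _).not_gt]

lemma rankIdx_natVec_last {n : ℕ} (v : Fin (n + 1) → ℤ) :
    rankIdx (natVec v) (Fin.last n) = rankIdx v 0 := by
  rw [rankIdx, rankIdx, Fin.sum_univ_castSucc, Fin.sum_univ_succ, add_comm]
  simp [natVec, Fin.tail, Fin.castSucc_lt_last,
    (Fin.castSucc_lt_last _).not_gt]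

lemma rankIdx_snoc_castSucc {n : ℕ} (w : Fin n → ℤ) (hw : ∀ i, 0 ≤ w i) (i : Fin n) :
    rankIdx (Fin.snoc (α := fun _ => ℤ) w 0) i.castSucc = rankIdx w i := by
  rw [rankIdx, rankIdx, Fin.sum_univ_castSucc]
  simp [(hw i).not_gt, (Fin.castSucc_lt_last _).not_gt]

lemma rankIdx_snoc_last {n : ℕ} (w : Fin n → ℤ) (hw : ∀ i, 0 ≤ w i) :
    rankIdx (Fin.snoc (α := fun _ => ℤ) w 0) (Fin.last n) = n := by
  rw [rankIdx, Fin.sum_univ_castSucc]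
  simp [hw, Fin.castSucc_lt_last]

/-- For unequal neighbours, ≥ and > agree between the two, and their order relative to every other
index is unaffected because they are adjacent. -/
lemma rankIdx_swapEntries {n : ℕ} (v : Fin (n + 1) → ℤ) (i : Fin n)
    (h : v i.castSucc ≠ v i.succ) (j : Fin (n + 1)) :
    rankIdx (swapEntries i v) j = rankIdx v (Equiv.swap i.castSucc i.succ j) := by
  rw [rankIdx, rankIdx, ← Equiv.sum_comp (Equiv.swap i.castSucc i.succ)
    (fun k => if (k < _ ∧ _ ≤ v k) ∨ (_ < k ∧ _ < v k) then 1 else 0)]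
  refine Finset.sum_congr rfl fun k _ => ?_
  congr 1
  simp only [swapEntries, Function.comp, Equiv.swap_apply_def, eq_iff_iff]
  have hs : (i.castSucc : Fin (n + 1)).val + 1 = i.succ.val := by simp
  generalize i.castSucc = a at *
  generalize i.succ = b at *
  split_ifs <;> simp only [Fin.lt_def, Fin.ext_iff, ← ne_eq] at * <;> omega

lemma rankIdx_succ_of_eq {n : ℕ} (v : Fin (n + 1) → ℤ) (i : Fin n)
    (h : v i.castSucc = v i.succ) : rankIdx v i.succ = rankIdx v i.castSucc + 1 := by
  -- The extra 1 is the contribution of k = i to the count at i + 1; as an indicator sum it permits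
  -- a termwise comparison.
  have h1 : (1 : ℕ) = ∑ k, if k = i.castSucc then 1 else 0 := by simp
  suffices H : rankIdx v i.succ = rankIdx v i.castSucc + ∑ k, if k = i.castSucc then 1 else 0 from
    H.trans (congrArg _ h1.symm)
  rw [rankIdx, rankIdx, ← Finset.sum_add_distrib]
  refine Finset.sum_congr rfl fun k _ => ?_
  have hs : (i.castSucc : Fin (n + 1)).val + 1 = i.succ.val := by simp
  generalize i.castSucc = a at *
  generalize i.succ = b at *
  by_cases hka : k = a
  · have h2 : a < b := by simp only [Fin.lt_def]; omega
    simp [hka, h, h2]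
  · have h2 : k < b ↔ k < a := by simp only [Fin.lt_def, Fin.ext_iff] at *; omega
    by_cases hkb : k = b
    · have h4 : a < b := by simp only [Fin.lt_def]; omega
      simp [hkb, h, h4.ne', h4.le]
    · have h3 : b < k ↔ a < k := by simp only [Fin.lt_def, Fin.ext_iff] at *; omega
      simp [h, hka, h2, h3]

lemma rankIdx_add_const {n : ℕ} (v : Fin n → ℤ) (m : ℤ) (i : Fin n) :
    rankIdx (fun j => v j + m) i = rankIdx v i := by
  simp [rankIdx]

/-- The spectral point with coordinates `q ^ (v_i) * t ^ (-k_i(v))`. -/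
def specPt (q t : k) {n : ℕ} (v : Fin n → ℤ) (i : Fin n) : k :=
  q ^ v i * t ^ (-(rankIdx v i : ℤ))

lemma barF_eq_specPt {n : ℕ} (v : Fin (n + 1) → ℤ) : barF v = specPt qF tF v := by
  funext i
  rw [barF, specPt, kIndex_eq_rankIdx]

lemma barK_eq_specPt {n : ℕ} (v : Fin (n + 1) → ℤ) : barK v = specPt qK tK v := by
  funext i
  rw [barK, barF, specPt, kIndex_eq_rankIdx, map_mul, map_zpow₀, map_zpow₀]
  rfl

/-- The map `z ↦ (z_2, …, z_N, g z_1)`. -/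
def rotate {A : Type*} (g : A → A) {n : ℕ} (z : Fin (n + 1) → A) : Fin (n + 1) → A :=
  Fin.snoc (Fin.tail z) (g (z 0))

/-- The parameters `q, t` are nonzero, and no nontrivial power of `q` is a power of `t`. -/
structure GenericParams (q t : k) : Prop where
  q_ne_zero : q ≠ 0
  t_ne_zero : t ≠ 0
  eq_zero : ∀ a b : ℤ, q ^ a = t ^ b → a = 0

lemma specPt_natVec {q t : k} (hq : q ≠ 0) {n : ℕ} (v : Fin (n + 1) → ℤ) :
    specPt q t (natVec v) = rotate (q * ·) (specPt q t v) := by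
  funext i
  refine Fin.lastCases ?_ (fun i => ?_) i
  · simp only [rotate, Fin.snoc_last, specPt, rankIdx_natVec_last]
    simp [natVec, zpow_one_add₀ hq, add_comm (v 0), mul_assoc]
  · simp only [rotate, Fin.snoc_castSucc, specPt, rankIdx_natVec_castSucc, Fin.tail]
    simp [natVec, Fin.tail]

lemma specPt_snoc {q t : k} {n : ℕ} (w : Fin n → ℤ) (hw : ∀ i, 0 ≤ w i) :
    specPt q t (Fin.snoc (α := fun _ => ℤ) w 0) =
      Fin.snoc (α := fun _ => k) (specPt q t w) (t ^ (-(n : ℤ))) := by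
  funext i
  refine Fin.lastCases ?_ (fun i => ?_) i
  · simp [specPt, rankIdx_snoc_last w hw]
  · simp [specPt, rankIdx_snoc_castSucc w hw]

lemma specPt_swapEntries {q t : k} {n : ℕ} (v : Fin (n + 1) → ℤ) (i : Fin n)
    (h : v i.castSucc ≠ v i.succ) :
    specPt q t (swapEntries i v) = specPt q t v ∘ Equiv.swap i.castSucc i.succ := by
  funext j
  simp only [specPt, rankIdx_swapEntries v i h, Function.comp]
  rfl

lemma specPt_castSucc_of_eq {q t : k} (ht : t ≠ 0) {n : ℕ} (v : Fin (n + 1) → ℤ) (i : Fin n)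
    (h : v i.castSucc = v i.succ) :
    specPt q t v i.castSucc = t * specPt q t v i.succ := by
  simp only [specPt, rankIdx_succ_of_eq v i h, h]
  rw [mul_left_comm, ← zpow_one_add₀ ht]
  congr 2
  push_cast
  ring

lemma specPt_add_const {q t : k} (hq : q ≠ 0) {n : ℕ} (v : Fin n → ℤ) (m : ℤ) (i : Fin n) :
    specPt q t (fun j => v j + m) i = q ^ m * specPt q t v i := by
  simp only [specPt, rankIdx_add_const, zpow_add₀ hq]
  ring

lemma specPt_eq_imp {q t : k} (h : GenericParams q t) {n : ℕ} (v : Fin n → ℤ) (i j : Fin n)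
    (b : ℤ) (e : specPt q t v i = t ^ b * specPt q t v j) : v i = v j := by
  have h1 := h.eq_zero (v i - v j) (b + rankIdx v i - rankIdx v j) (by
    simp only [specPt] at e
    have := h.q_ne_zero
    have := h.t_ne_zero
    rw [zpow_sub₀ h.q_ne_zero, zpow_sub₀ h.t_ne_zero, zpow_add₀ h.t_ne_zero, div_eq_div_iff
      (zpow_ne_zero _ h.q_ne_zero) (zpow_ne_zero _ h.t_ne_zero)]
    simp only [zpow_neg] at e
    field_simp at e
    linear_combination e)
  omega

lemma specPt_ne_zero {q t : k} (h : GenericParams q t) {n : ℕ} (v : Fin n → ℤ) (i : Fin n) :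
    specPt q t v i ≠ 0 :=
  mul_ne_zero (zpow_ne_zero _ h.q_ne_zero) (zpow_ne_zero _ h.t_ne_zero)

lemma specPt_ne_zpow {q t : k} (h : GenericParams q t) {n : ℕ} (v : Fin n → ℤ) (i : Fin n)
    (hv : v i ≠ 0) (b : ℤ) : specPt q t v i ≠ t ^ b := by
  intro e
  refine hv (h.eq_zero (v i) (b + rankIdx v i) ?_)
  rw [zpow_add₀ h.t_ne_zero, ← e, specPt, mul_assoc, ← zpow_add₀ h.t_ne_zero]
  simp

lemma genericParams_FF : GenericParams qF tF := by
  have key : ∀ a b c d : ℕ, qF ^ a * tF ^ b = qF ^ c * tF ^ d → a = c := by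
    intro a b c d h
    rw [qF, tF, ← map_pow, ← map_pow, ← map_pow, ← map_pow, ← map_mul, ← map_mul] at h
    have h2 := IsFractionRing.injective (MvPolynomial (Fin 2) ℚ) FF h
    have h3 := congrArg (MvPolynomial.coeff (Finsupp.single 0 a + Finsupp.single 1 b)) h2
    simp only [MvPolynomial.X_pow_eq_monomial, MvPolynomial.monomial_mul, mul_one,
      MvPolynomial.coeff_monomial] at h3
    by_contra hne
    simp only [if_true] at h3
    rw [if_neg] at h3
    · exact one_ne_zero h3
    · intro h4
      have := DFunLike.congr_fun h4 0
      simp at this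
      exact hne this.symm
  refine ⟨qF_ne_zero, tF_ne_zero, fun a b h => ?_⟩
  -- Negative exponents are moved across, giving an equality of monomials in the polynomial ring.
  have h1 : qF ^ a.toNat * tF ^ (-b).toNat = qF ^ (-a).toNat * tF ^ b.toNat := by
    rw [← zpow_natCast, ← zpow_natCast, ← zpow_natCast, ← zpow_natCast]
    have ha : ((a.toNat : ℕ) : ℤ) = a + ((-a).toNat : ℕ) := by omega
    have hb : ((b.toNat : ℕ) : ℤ) = b + ((-b).toNat : ℕ) := by omega
    rw [ha, hb, zpow_add₀ qF_ne_zero, zpow_add₀ tF_ne_zero, h]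
    ring
  have := key _ _ _ _ h1
  omega

lemma genericParams_KK : GenericParams qK tK := by
  refine ⟨qK_ne_zero, ?_, fun a b h => ?_⟩
  · simpa [tK] using tF_ne_zero
  · refine genericParams_FF.eq_zero a b ?_
    rw [qK, tK, ← map_zpow₀, ← map_zpow₀] at h
    exact (algebraMap FF KK).injective h

/-! ### Unisolvence of the interpolation problem -/

/-- Homomorphisms that agree modulo d on the variables agree modulo d everywhere. This is the source
of all divisions below: by x_N - c, by x_i - x_{i+1} and by x_j. -/
lemma dvd_algHom_sub_algHom {σ R A : Type*} [CommRing R] [CommRing A] [Algebra R A]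
    (φ ψ : MvPolynomial σ R →ₐ[R] A) (d : A)
    (h : ∀ i, d ∣ φ (MvPolynomial.X i) - ψ (MvPolynomial.X i)) (p : MvPolynomial σ R) :
    d ∣ φ p - ψ p := by
  induction p using MvPolynomial.induction_on with
  | C a => simp [← MvPolynomial.algebraMap_eq]
  | add p p' hp hp' =>
    rw [map_add, map_add, add_sub_add_comm]
    exact dvd_add hp hp'
  | mul_X p i hp =>
    have e : φ (p * MvPolynomial.X i) - ψ (p * MvPolynomial.X i) =
        φ p * (φ (MvPolynomial.X i) - ψ (MvPolynomial.X i)) +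
          (φ p - ψ p) * ψ (MvPolynomial.X i) := by
      rw [map_mul, map_mul]; ring
    rw [e]
    exact dvd_add (Dvd.dvd.mul_left (h i) _) (Dvd.dvd.mul_right hp _)

lemma totalDegree_aeval_le {σ ι R : Type*} [CommRing R] (f : σ → MvPolynomial ι R)
    (hf : ∀ i, (f i).totalDegree ≤ 1) (p : MvPolynomial σ R) :
    (MvPolynomial.aeval f p).totalDegree ≤ p.totalDegree := by
  rw [MvPolynomial.aeval_def, MvPolynomial.eval₂_eq]
  refine MvPolynomial.totalDegree_finsetSum_le fun m hm => ?_
  refine (MvPolynomial.totalDegree_mul _ _).trans ?_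
  rw [MvPolynomial.algebraMap_eq, MvPolynomial.totalDegree_C, zero_add]
  refine (MvPolynomial.totalDegree_finsetProd _ _).trans
    (le_trans (Finset.sum_le_sum fun i _ => ?_) (MvPolynomial.le_totalDegree hm))
  refine (MvPolynomial.totalDegree_pow _ _).trans ?_
  exact (Nat.mul_le_mul_left _ (hf i)).trans (by simp)

/-- The restriction of a polynomial to the hyperplane where the last variable equals `c`. -/
def restrictLast {n : ℕ} (c : k) :
    MvPolynomial (Fin (n + 1)) k →ₐ[k] MvPolynomial (Fin n) k :=
  MvPolynomial.aeval (Fin.snoc (α := fun _ => MvPolynomial (Fin n) k) MvPolynomial.X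
    (MvPolynomial.C c))

lemma eval_restrictLast {n : ℕ} (c : k) (p : MvPolynomial (Fin (n + 1)) k) (y : Fin n → k) :
    MvPolynomial.eval y (restrictLast c p) =
      MvPolynomial.eval (Fin.snoc (α := fun _ => k) y c) p := by
  have : (MvPolynomial.aeval (R := k) y).comp (restrictLast c) =
      MvPolynomial.aeval (Fin.snoc (α := fun _ => k) y c) := by
    ext i
    refine Fin.lastCases ?_ (fun i => ?_) i <;> simp [restrictLast]
  simpa [MvPolynomial.aeval_eq_eval] using DFunLike.congr_fun this p

lemma totalDegree_restrictLast_le {n : ℕ} (c : k) (p : MvPolynomial (Fin (n + 1)) k) :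
    (restrictLast c p).totalDegree ≤ p.totalDegree := by
  refine totalDegree_aeval_le _ (fun i => ?_) p
  refine Fin.lastCases ?_ (fun i => ?_) i <;> simp

lemma exists_eq_rename_restrictLast_add {n : ℕ} (c : k) (p : MvPolynomial (Fin (n + 1)) k) :
    ∃ g, p = MvPolynomial.rename Fin.castSucc (restrictLast c p) +
      (MvPolynomial.X (Fin.last n) - MvPolynomial.C c) * g := by
  obtain ⟨g, hg⟩ := dvd_algHom_sub_algHom (AlgHom.id k (MvPolynomial (Fin (n + 1)) k))
    ((MvPolynomial.rename Fin.castSucc).comp (restrictLast c))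
    (MvPolynomial.X (Fin.last n) - MvPolynomial.C c) (fun i => by
      refine Fin.lastCases ?_ (fun i => ?_) i <;> simp [restrictLast]) p
  exact ⟨g, by rw [← hg]; simp⟩

lemma totalDegree_X_sub_C {σ : Type*} (i : σ) (c : k) :
    (MvPolynomial.X i - MvPolynomial.C c : MvPolynomial σ k).totalDegree = 1 := by
  rw [sub_eq_add_neg, ← MvPolynomial.C_neg,
    MvPolynomial.totalDegree_add_eq_left_of_totalDegree_lt] <;> simp

lemma X_sub_C_ne_zero {σ : Type*} (i : σ) (c : k) :
    (MvPolynomial.X i - MvPolynomial.C c : MvPolynomial σ k) ≠ 0 := by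
  intro h
  simpa [h] using totalDegree_X_sub_C i c

/-- The substitution `g(x_1, …, x_N) ↦ g(x_2, …, x_N, q x_1)`. -/
def unrotate {n : ℕ} (q : k) :
    MvPolynomial (Fin (n + 1)) k →ₐ[k] MvPolynomial (Fin (n + 1)) k :=
  MvPolynomial.aeval (rotate (MvPolynomial.C q * ·) MvPolynomial.X)

lemma eval_unrotate {n : ℕ} (q : k) (g : MvPolynomial (Fin (n + 1)) k) (z : Fin (n + 1) → k) :
    MvPolynomial.eval z (unrotate q g) = MvPolynomial.eval (rotate (q * ·) z) g := by
  have : (MvPolynomial.aeval (R := k) z).comp (unrotate q) =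
      MvPolynomial.aeval (rotate (q * ·) z) := by
    ext i
    refine Fin.lastCases ?_ (fun i => ?_) i <;> simp [unrotate, rotate, Fin.tail]
  simpa [MvPolynomial.aeval_eq_eval] using DFunLike.congr_fun this g

lemma totalDegree_unrotate_le {n : ℕ} (q : k) (g : MvPolynomial (Fin (n + 1)) k) :
    (unrotate q g).totalDegree ≤ g.totalDegree := by
  refine totalDegree_aeval_le _ (fun i => ?_) g
  refine Fin.lastCases ?_ (fun i => ?_) i
  · simp only [rotate, Fin.snoc_last]
    exact (MvPolynomial.totalDegree_mul _ _).trans (by simp)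
  · simp [rotate, Fin.tail]

lemma unrotate_injective {n : ℕ} {q : k} (hq : q ≠ 0) :
    Function.Injective (unrotate (n := n) q) := by
  have : (MvPolynomial.aeval (R := k) (Fin.cons (α := fun _ => MvPolynomial (Fin (n + 1)) k)
      (MvPolynomial.C q⁻¹ * MvPolynomial.X (Fin.last n))
      fun i : Fin n => MvPolynomial.X i.castSucc)).comp (unrotate q) = AlgHom.id k _ := by
    ext1 i
    refine Fin.lastCases ?_ (fun i => ?_) i
    · simp [unrotate, rotate, ← mul_assoc, ← MvPolynomial.C_mul, MvPolynomial.algebraMap_eq, hq]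
    · simp [unrotate, rotate, Fin.tail]
  intro g g' e
  have h1 := DFunLike.congr_fun this g
  have h2 := DFunLike.congr_fun this g'
  rw [AlgHom.comp_apply, AlgHom.id_apply] at h1 h2
  rw [← h1, e, h2]

lemma monomial_eq_prod {σ : Type*} [Fintype σ] (u : σ →₀ ℕ) (a : k) :
    MvPolynomial.monomial u a = MvPolynomial.C a * ∏ i, MvPolynomial.X i ^ u i := by
  rw [MvPolynomial.monomial_eq, Finsupp.prod_fintype _ _ (by simp)]

lemma coeff_unrotate {n : ℕ} (q : k) (g : MvPolynomial (Fin (n + 1)) k) (b : Fin (n + 1) → ℕ) :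
    (unrotate q g).coeff (Finsupp.equivFunOnFinite.symm b) =
      q ^ b 0 * g.coeff (Finsupp.equivFunOnFinite.symm (rotate id b)) := by
  induction g using MvPolynomial.induction_on' with
  | add g g' h h' => rw [map_add, MvPolynomial.coeff_add, MvPolynomial.coeff_add, h, h', mul_add]
  | monomial u a =>
    have e : unrotate q (MvPolynomial.monomial u a) = MvPolynomial.monomial
        (Finsupp.equivFunOnFinite.symm (Fin.cons (u (Fin.last n)) fun i : Fin n => u i.castSucc))
        (q ^ u (Fin.last n) * a) := by
      rw [monomial_eq_prod, monomial_eq_prod, map_mul, map_prod, Fin.prod_univ_castSucc,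
        Fin.prod_univ_succ]
      simp [unrotate, rotate, Fin.tail, mul_pow, MvPolynomial.algebraMap_eq]
      ring
    have hiff : Finsupp.equivFunOnFinite.symm
        (Fin.cons (u (Fin.last n)) fun i : Fin n => u i.castSucc) =
          Finsupp.equivFunOnFinite.symm b ↔
        u = Finsupp.equivFunOnFinite.symm (rotate id b) := by
      constructor
      · intro h
        have h := Finsupp.equivFunOnFinite.symm.injective h
        subst h
        ext i
        refine Fin.lastCases ?_ (fun i => ?_) i <;> simp [rotate]
      · rintro rfl
        congr 1
        funext i
        refine Fin.cases ?_ (fun i => ?_) i <;> simp [rotate, Fin.tail]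
    rw [e, MvPolynomial.coeff_monomial, MvPolynomial.coeff_monomial]
    simp only [hiff]
    split_ifs with h
    · subst h
      simp [rotate]
    · simp

/-- One step of the descent. The linear factor is nonzero at the point of v^♮, whose last entry is
positive, so the zero of p there is a zero of the quotient g; rotating back places it at v̄. -/
lemma exists_unrotate_of_restrictLast_eq_zero {q t : k} (h : GenericParams q t) {n : ℕ}
    (p : MvPolynomial (Fin (n + 1)) k) (hp : restrictLast (t ^ (-(n : ℤ))) p = 0) (hp0 : p ≠ 0) :
    ∃ g, p = (MvPolynomial.X (Fin.last n) - MvPolynomial.C (t ^ (-(n : ℤ)))) * g ∧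
      (g.totalDegree + 1 = p.totalDegree) ∧ unrotate q g ≠ 0 ∧
      ∀ v : Fin (n + 1) → ℤ, (∀ i, 0 ≤ v i) →
        MvPolynomial.eval (specPt q t (natVec v)) p = 0 →
          MvPolynomial.eval (specPt q t v) (unrotate q g) = 0 := by
  obtain ⟨g, hg⟩ := exists_eq_rename_restrictLast_add (t ^ (-(n : ℤ))) p
  rw [hp, map_zero, zero_add] at hg
  have hg0 : g ≠ 0 := by rintro rfl; simp [hp0] at hg
  refine ⟨g, hg, ?_, ?_, fun v hv h0 => ?_⟩
  · rw [hg, MvPolynomial.totalDegree_mul_of_isDomain (X_sub_C_ne_zero _ _) hg0,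
      totalDegree_X_sub_C, add_comm]
  · rwa [Ne, map_eq_zero_iff _ (unrotate_injective h.q_ne_zero)]
  · rw [hg, map_mul, mul_eq_zero] at h0
    rcases h0 with h0 | h0
    · exfalso
      simp only [map_sub, MvPolynomial.eval_X, MvPolynomial.eval_C, sub_eq_zero] at h0
      refine specPt_ne_zpow h (natVec v) (Fin.last n) ?_ _ h0
      have := hv 0
      simp only [natVec, Fin.snoc_last]
      omega
    · rwa [eval_unrotate, ← specPt_natVec h.q_ne_zero]

lemma sum_natVec {n : ℕ} (v : Fin (n + 1) → ℤ) : ∑ i, natVec v i = ∑ i, v i + 1 := by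
  rw [Fin.sum_univ_castSucc, Fin.sum_univ_succ]
  simp [natVec, Fin.tail]
  ring

lemma natVec_nonneg {n : ℕ} {v : Fin (n + 1) → ℤ} (hv : ∀ i, 0 ≤ v i) (i : Fin (n + 1)) :
    0 ≤ natVec v i := by
  refine Fin.lastCases ?_ (fun i => ?_) i
  · simpa [natVec] using (hv 0).trans (by omega)
  · simpa [natVec, Fin.tail] using hv i.succ

lemma snoc_zero_nonneg {n : ℕ} {v : Fin n → ℤ} (hv : ∀ i, 0 ≤ v i) (i : Fin (n + 1)) :
    0 ≤ Fin.snoc (α := fun _ => ℤ) v 0 i := by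
  refine Fin.lastCases ?_ (fun i => ?_) i <;> simp [hv]

lemma eval_spec_restrictLast {q t : k} {n : ℕ} (p : MvPolynomial (Fin (n + 1)) k)
    {v : Fin n → ℤ} (hv : ∀ i, 0 ≤ v i) :
    MvPolynomial.eval (specPt q t v) (restrictLast (t ^ (-(n : ℤ))) p) =
      MvPolynomial.eval (specPt q t (Fin.snoc (α := fun _ => ℤ) v 0)) p := by
  rw [eval_restrictLast, specPt_snoc v hv]

/-- A polynomial of degree at most `d` vanishing at all spectral points of compositions of weight
at most `d` is zero. -/
theorem eq_zero_of_vanishing {q t : k} (h : GenericParams q t) :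
    ∀ {n : ℕ} (p : MvPolynomial (Fin n) k) (d : ℕ), p.totalDegree ≤ d →
      (∀ v : Fin n → ℤ, (∀ i, 0 ≤ v i) → ∑ i, v i ≤ d →
        MvPolynomial.eval (specPt q t v) p = 0) → p = 0 := by
  intro n
  induction n with
  | zero =>
    intro p d _ hv
    rw [MvPolynomial.eq_C_of_isEmpty p] at hv ⊢
    have := hv (fun _ => 0) (by simp) (by simp)
    rw [MvPolynomial.eval_C] at this
    rw [this, map_zero]
  | succ n ih =>
    intro p d
    induction d generalizing p with
    | zero =>
      intro hd hv
      rw [MvPolynomial.totalDegree_eq_zero_iff_eq_C.1 (Nat.le_zero.1 hd)] at hv ⊢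
      have := hv (fun _ => 0) (by simp) (by simp)
      rw [MvPolynomial.eval_C] at this
      rw [this, map_zero]
    | succ d ihd =>
      intro hd hv
      by_contra hp0
      -- Induction on the number of variables, with the same weight bound: compositions of the form
      -- (v, 0).
      have hr : restrictLast (t ^ (-(n : ℤ))) p = 0 := by
        refine ih _ (d + 1) ((totalDegree_restrictLast_le _ _).trans hd) fun v hv0 hvs => ?_
        rw [eval_spec_restrictLast p hv0]
        refine hv _ (snoc_zero_nonneg hv0) ?_
        rw [Fin.sum_univ_castSucc]
        simpa using hvs
      obtain ⟨g, hg, hdeg, hne, hev⟩ := exists_unrotate_of_restrictLast_eq_zero h p hr hp0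
      -- Induction on the weight bound: v has weight at most d exactly when v^♮ has weight at most d
      -- + 1.
      refine hne (ihd _ ((totalDegree_unrotate_le _ _).trans (by omega)) fun v hv0 hvs => ?_)
      refine hev v hv0 (hv _ (natVec_nonneg hv0) ?_)
      rw [sum_natVec]
      push_cast
      linarith

/-! ### Polynomials of a given type and their uniqueness -/

/-- The polynomial `p` has degree at most `|v|` and vanishes at all spectral points of
compositions of weight at most `|v|` different from `v`. -/
structure HasType (q t : k) {n : ℕ} (v : Fin n → ℤ) (p : MvPolynomial (Fin n) k) : Prop where
  degree_le : (p.totalDegree : ℤ) ≤ ∑ i, v i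
  vanishing : ∀ w : Fin n → ℤ, (∀ i, 0 ≤ w i) → ∑ i, w i ≤ ∑ i, v i → w ≠ v →
    MvPolynomial.eval (specPt q t w) p = 0

lemma HasType.eq_zero {q t : k} (h : GenericParams q t) {n : ℕ} {v : Fin n → ℤ}
    {p : MvPolynomial (Fin n) k} (hp : HasType q t v p)
    (h0 : MvPolynomial.eval (specPt q t v) p = 0) : p = 0 := by
  refine eq_zero_of_vanishing h p (∑ i, v i).toNat ?_ fun w hw hs => ?_
  -- The degree bound forces |v| ≥ 0, so the truncation `toNat` loses nothing.
  · have := hp.degree_le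
    omega
  · by_cases hwv : w = v
    · rwa [hwv]
    · refine hp.vanishing w hw ?_ hwv
      have := hp.degree_le
      omega

/-- The polynomial and its restriction differ by (x_N - c) g. A monomial free of x_N does not occur
in x_N g, and one of weight at least deg p exceeds the degree of c g. -/
lemma coeff_restrictLast {n : ℕ} (c : k) (p : MvPolynomial (Fin (n + 1)) k)
    (b : Fin n → ℕ) (hp : p.totalDegree ≤ ∑ i, b i) :
    (restrictLast c p).coeff (Finsupp.equivFunOnFinite.symm b) =
      p.coeff (Finsupp.equivFunOnFinite.symm (Fin.snoc (α := fun _ => ℕ) b 0)) := by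
  obtain ⟨g, hg⟩ := exists_eq_rename_restrictLast_add c p
  have hb : Finsupp.equivFunOnFinite.symm (Fin.snoc (α := fun _ => ℕ) b 0) =
      Finsupp.mapDomain Fin.castSucc (Finsupp.equivFunOnFinite.symm b) := by
    ext i
    refine Fin.lastCases ?_ (fun i => ?_) i
    · rw [Finsupp.mapDomain_of_notMem_range]
      · simp
      · rintro ⟨j, hj⟩
        exact (Fin.castSucc_lt_last j).ne hj
    · rw [Finsupp.mapDomain_apply (Fin.castSucc_injective n)]
      simp
  have h0 : MvPolynomial.coeff (Finsupp.equivFunOnFinite.symm (Fin.snoc (α := fun _ => ℕ) b 0))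
      ((MvPolynomial.X (Fin.last n) - MvPolynomial.C c) * g) = 0 := by
    by_cases hg0 : g = 0
    · simp [hg0]
    have hd : (MvPolynomial.X (Fin.last n) - MvPolynomial.C c) * g =
        p - MvPolynomial.rename Fin.castSucc (restrictLast c p) := by
      linear_combination -hg
    have hd2 : ((MvPolynomial.X (Fin.last n) - MvPolynomial.C c) * g).totalDegree ≤ ∑ i, b i := by
      rw [hd]
      refine (MvPolynomial.totalDegree_sub _ _).trans (max_le hp ?_)
      exact ((MvPolynomial.totalDegree_rename_le _ _).trans
        (totalDegree_restrictLast_le _ _)).trans hp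
    rw [MvPolynomial.totalDegree_mul_of_isDomain (X_sub_C_ne_zero _ _) hg0,
      totalDegree_X_sub_C] at hd2
    rw [sub_mul, MvPolynomial.coeff_sub, MvPolynomial.coeff_X_mul', if_neg (by simp),
      MvPolynomial.coeff_C_mul, MvPolynomial.coeff_eq_zero_of_totalDegree_lt]
    · simp
    · rw [← Finsupp.degree_apply, Finsupp.degree_eq_sum, Fin.sum_univ_castSucc]
      simp
      omega
  conv_rhs => rw [hg]
  rw [MvPolynomial.coeff_add, h0, add_zero, hb,
    MvPolynomial.coeff_rename_mapDomain _ (Fin.castSucc_injective n)]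

/-- A polynomial of type `α` in which the coefficient of `x ^ α` vanishes is zero. -/
theorem HasType.eq_zero_of_coeff {q t : k} (h : GenericParams q t) :
    ∀ {n : ℕ} (α : Fin n → ℕ) (p : MvPolynomial (Fin n) k),
      HasType q t (fun i => (α i : ℤ)) p →
      p.coeff (Finsupp.equivFunOnFinite.symm α) = 0 → p = 0 := by
  intro n
  induction n with
  | zero =>
    intro α p _ hc
    ext m
    rw [Subsingleton.elim m (Finsupp.equivFunOnFinite.symm α), hc, MvPolynomial.coeff_zero]
  | succ n ih =>
    intro α
    induction hd : ∑ i, α i generalizing α with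
    | zero =>
      intro p hp hc
      have hα : α = 0 := by
        funext i
        exact (Finset.sum_eq_zero_iff.1 hd) i (Finset.mem_univ i)
      have hdeg := hp.degree_le
      rw [← Nat.cast_sum, hd, Nat.cast_le, Nat.le_zero,
        MvPolynomial.totalDegree_eq_zero_iff_eq_C] at hdeg
      rw [hdeg]
      have : Finsupp.equivFunOnFinite.symm α = 0 := by ext; simp [hα]
      rw [this] at hc
      rw [hc, map_zero]
    | succ d ihd =>
      intro p hp hc
      have hsum : ∑ i, (α i : ℤ) = d + 1 := by exact_mod_cast hd
      -- If α = (b, 0), the restriction has type b and vanishing coefficient of x^b, so it is zero;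
      -- hence p also vanishes at ᾱ, the only point left open by its type.
      by_cases hl : α (Fin.last n) = 0
      · obtain ⟨b, rfl⟩ : ∃ b : Fin n → ℕ, α = Fin.snoc (α := fun _ => ℕ) b 0 :=
          ⟨Fin.init α, by rw [← hl, Fin.snoc_init_self]⟩
        have hb : (fun i => ((Fin.snoc (α := fun _ => ℕ) b 0 i : ℕ) : ℤ)) =
            Fin.snoc (α := fun _ => ℤ) (fun i => (b i : ℤ)) 0 := by
          funext i
          refine Fin.lastCases ?_ (fun i => ?_) i <;> simp
        have hs : ∑ i, b i = d + 1 := by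
          rw [Fin.sum_univ_castSucc] at hd
          simpa using hd
        have hs' : ∑ i, (b i : ℤ) = d + 1 := by exact_mod_cast hs
        have hdeg := hp.degree_le
        rw [hsum] at hdeg
        refine hp.eq_zero h ?_
        rw [hb, ← eval_spec_restrictLast p (by simp),
          ih b (restrictLast (t ^ (-(n : ℤ))) p) ⟨?_, fun v hv hvs hne => ?_⟩ ?_, map_zero]
        · rw [hs']
          have := totalDegree_restrictLast_le (t ^ (-(n : ℤ))) p
          omega
        · rw [coeff_restrictLast _ _ _ (by omega), hc]
        · rw [eval_spec_restrictLast p hv]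
          refine hp.vanishing _ (snoc_zero_nonneg hv) ?_ ?_
          · rw [hb, Fin.sum_univ_castSucc, Fin.sum_univ_castSucc]
            simpa using hvs
          · rw [hb]
            exact fun e => hne (Fin.snoc_injective2 e).1
      · by_contra hp0
        obtain ⟨b, rfl⟩ : ∃ b : Fin (n + 1) → ℕ, α = rotate (· + 1) b := by
          refine ⟨Fin.cons (α (Fin.last n) - 1) (Fin.init α), ?_⟩
          funext i
          refine Fin.lastCases ?_ (fun i => ?_) i
          · simp [rotate]
            omega
          · simp [rotate, Fin.init]
        have hb : (fun i => ((rotate (· + 1) b i : ℕ) : ℤ)) = natVec fun i => (b i : ℤ) := by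
          funext i
          refine Fin.lastCases ?_ (fun i => ?_) i <;> simp [natVec, rotate, Fin.tail]
        have hs' : ∑ i, (b i : ℤ) = d := by
          rw [hb, sum_natVec] at hsum
          linarith
        have hs : ∑ i, b i = d := by exact_mod_cast hs'
        have hdeg := hp.degree_le
        rw [hsum] at hdeg
        -- With α_N > 0 no composition (v, 0) equals α, so p vanishes at all relevant points of the
        -- hyperplane and unisolvence applies in fewer variables.
        have hr : restrictLast (t ^ (-(n : ℤ))) p = 0 := by
          refine eq_zero_of_vanishing h _ (d + 1)
            ((totalDegree_restrictLast_le _ _).trans (by omega)) fun v hv hvs => ?_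
          rw [eval_spec_restrictLast p hv]
          refine hp.vanishing _ (snoc_zero_nonneg hv) ?_ fun e => ?_
          · rw [hsum, Fin.sum_univ_castSucc]
            simpa using hvs
          · have := congrFun e (Fin.last n)
            simp only [Fin.snoc_last] at this
            exact hl (by exact_mod_cast this.symm)
        obtain ⟨g, hg, hgdeg, hne, hev⟩ := exists_unrotate_of_restrictLast_eq_zero h p hr hp0
        refine hne (ihd b hs (unrotate q g) ⟨?_, fun v hv hvs hvb => ?_⟩ ?_)
        · rw [hs']
          have := totalDegree_unrotate_le q g
          omega
        · refine hev v hv (hp.vanishing _ (natVec_nonneg hv) ?_ ?_)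
          · rw [hb, sum_natVec, sum_natVec]
            linarith
          · rw [hb]
            intro e
            apply hvb
            rw [← sharpVec_natVec v, e, sharpVec_natVec]
        -- Since deg g < |α|, the coefficient of x^α in p = (x_N - c) g is that of x^α / x_N in g,
        -- which unrotation turns into the coefficient of x^b up to a power of q.
        · have he : Finsupp.equivFunOnFinite.symm (rotate (· + 1) b) =
              Finsupp.single (Fin.last n) 1 + Finsupp.equivFunOnFinite.symm (rotate id b) := by
            ext i
            refine Fin.lastCases ?_ (fun i => ?_) i
            · simp [rotate, add_comm]
            · simp [rotate]
          rw [hg, sub_mul, MvPolynomial.coeff_sub, MvPolynomial.coeff_C_mul,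
            MvPolynomial.coeff_eq_zero_of_totalDegree_lt (f := g), mul_zero, sub_zero, he,
            MvPolynomial.coeff_X_mul] at hc
          · rw [coeff_unrotate, hc, mul_zero]
          · rw [← Finsupp.degree_apply, Finsupp.degree_eq_sum]
            simp only [Finsupp.equivFunOnFinite_symm_apply_apply]
            rw [hd]
            omega

/-! ### Existence of interpolation polynomials -/

lemma HasType.sub {q t : k} {n : ℕ} {v : Fin n → ℤ} {p p' : MvPolynomial (Fin n) k}
    (hp : HasType q t v p) (hp' : HasType q t v p') : HasType q t v (p - p') := by
  refine ⟨?_, fun w hw hs hne => ?_⟩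
  · have h1 := hp.degree_le
    have h2 := hp'.degree_le
    have h3 := MvPolynomial.totalDegree_sub p p'
    rcases le_max_iff.1 h3 with h | h <;> omega
  · rw [map_sub, hp.vanishing w hw hs hne, hp'.vanishing w hw hs hne, sub_zero]

lemma HasType.C_mul {q t : k} {n : ℕ} {v : Fin n → ℤ} {p : MvPolynomial (Fin n) k}
    (hp : HasType q t v p) (c : k) : HasType q t v (MvPolynomial.C c * p) := by
  refine ⟨?_, fun w hw hs hne => ?_⟩
  · have h1 := hp.degree_le
    have h3 := MvPolynomial.totalDegree_mul (MvPolynomial.C c) p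
    rw [MvPolynomial.totalDegree_C] at h3
    omega
  · rw [map_mul, hp.vanishing w hw hs hne, mul_zero]

/-- Two polynomials of the same type are proportional. -/
lemma HasType.eq_C_mul {q t : k} (h : GenericParams q t) {n : ℕ} {v : Fin n → ℤ}
    {p p' : MvPolynomial (Fin n) k} (hp : HasType q t v p) (hp' : HasType q t v p')
    (h0 : p' ≠ 0) : ∃ c, p = MvPolynomial.C c * p' := by
  have h1 : MvPolynomial.eval (specPt q t v) p' ≠ 0 := fun e => h0 (hp'.eq_zero h e)
  refine ⟨MvPolynomial.eval (specPt q t v) p / MvPolynomial.eval (specPt q t v) p',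
    sub_eq_zero.1 ((hp.sub (hp'.C_mul _)).eq_zero h ?_)⟩
  rw [map_sub, map_mul, MvPolynomial.eval_C, div_mul_cancel₀ _ h1, sub_self]

/-- Unknowns and equations are both indexed by the compositions of weight at most |α|, so uniqueness
yields existence. -/
theorem exists_hasType_coeff_eq_one {q t : k} (h : GenericParams q t) {n : ℕ}
    (α : Fin n → ℕ) : ∃ p, HasType q t (fun i => (α i : ℤ)) p ∧
      p.coeff (Finsupp.equivFunOnFinite.symm α) = 1 := by
  classical
  let S : Finset (Fin n → ℕ) :=
    (Fintype.piFinset fun _ => Finset.range (∑ i, α i + 1)).filter fun β => ∑ i, β i ≤ ∑ i, α i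
  have hS : ∀ β : Fin n → ℕ, β ∈ S ↔ ∑ i, β i ≤ ∑ i, α i := by
    intro β
    simp only [S, Finset.mem_filter, Fintype.mem_piFinset, Finset.mem_range, and_iff_right_iff_imp]
    intro hβ i
    have := Finset.single_le_sum (f := β) (fun i _ => Nat.zero_le _) (Finset.mem_univ i)
    omega
  let P : (S → k) →ₗ[k] MvPolynomial (Fin n) k :=
    ∑ β : S, (MvPolynomial.monomial (Finsupp.equivFunOnFinite.symm β.1)).comp
      (LinearMap.proj β)
  have hP : ∀ c, P c = ∑ β : S, MvPolynomial.monomial (Finsupp.equivFunOnFinite.symm β.1) (c β) :=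
    fun c => by simp [P, LinearMap.sum_apply]
  have hdeg : ∀ c, (P c).totalDegree ≤ ∑ i, α i := by
    intro c
    rw [hP]
    refine MvPolynomial.totalDegree_finsetSum_le fun β _ =>
      (MvPolynomial.totalDegree_monomial_le _ _).trans ?_
    rw [Finsupp.sum_fintype _ _ (by simp)]
    exact (hS β.1).1 β.2
  have hcoeff : ∀ c (β : S), (P c).coeff (Finsupp.equivFunOnFinite.symm β.1) = c β := by
    intro c β
    rw [hP, MvPolynomial.coeff_sum, Finset.sum_eq_single β]
    · simp
    · intro γ _ hγ
      rw [MvPolynomial.coeff_monomial, if_neg]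
      intro e
      exact hγ (Subtype.ext (Finsupp.equivFunOnFinite.symm.injective e))
    · simp
  -- The row of α records the coefficient of x^α in place of the value at ᾱ.
  let T : (S → k) →ₗ[k] (S → k) := LinearMap.pi fun β =>
    (if β.1 = α then MvPolynomial.lcoeff k (Finsupp.equivFunOnFinite.symm α)
      else (MvPolynomial.aeval (specPt q t fun i => (β.1 i : ℤ))).toLinearMap).comp P
  have hT : ∀ c (β : S), β.1 ≠ α → T c β =
      MvPolynomial.eval (specPt q t fun i => (β.1 i : ℤ)) (P c) := by
    intro c β hβ
    simp [T, hβ, MvPolynomial.aeval_eq_eval]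
  have hTα : ∀ c (β : S), β.1 = α → T c β =
      (P c).coeff (Finsupp.equivFunOnFinite.symm α) := by
    intro c β hβ
    simp [T, hβ]
  have htype : ∀ c, (∀ β : S, β.1 ≠ α → T c β = 0) →
      HasType q t (fun i => (α i : ℤ)) (P c) := by
    intro c hc
    refine ⟨by exact_mod_cast hdeg c, fun w hw hs hne => ?_⟩
    lift w to Fin n → ℕ using hw
    beta_reduce at hs
    have hw : w ∈ S := (hS w).2 (by exact_mod_cast hs)
    have hwα : w ≠ α := fun e => hne (by rw [e])
    exact (hT c ⟨w, hw⟩ hwα).symm.trans (hc ⟨w, hw⟩ hwα)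
  let α' : S := ⟨α, (hS α).2 le_rfl⟩
  have hinj : Function.Injective T := by
    rw [injective_iff_map_eq_zero]
    intro c hc
    have h0 : P c = 0 := HasType.eq_zero_of_coeff h α _
      (htype c fun β _ => by rw [hc, Pi.zero_apply])
      (by rw [← hTα c α' rfl, hc, Pi.zero_apply])
    funext β
    rw [← hcoeff c β, h0, MvPolynomial.coeff_zero, Pi.zero_apply]
  obtain ⟨c, hc⟩ := (LinearMap.injective_iff_surjective.1 hinj) (Pi.single α' 1)
  refine ⟨P c, htype c fun β hβ => ?_, ?_⟩
  · rw [hc, Pi.single_eq_of_ne]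
    exact fun e => hβ (by rw [e])
  · rw [← hTα c α' rfl, hc, Pi.single_eq_same]

lemma isInterpolation_iff {n : ℕ} (α : Fin (n + 1) → ℕ) (G : MvPolynomial (Fin (n + 1)) FF) :
    IsInterpolation α G ↔ HasType qF tF (fun i => (α i : ℤ)) G ∧
      G.coeff (Finsupp.equivFunOnFinite.symm α) = 1 := by
  constructor
  · intro hG
    refine ⟨⟨by exact_mod_cast hG.degree_le, fun w hw hs hne => ?_⟩, hG.coeff_eq_one⟩
    lift w to Fin (n + 1) → ℕ using hw
    beta_reduce at hs
    rw [← barF_eq_specPt]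
    exact hG.vanishing w (by exact_mod_cast hs) fun e => hne (by rw [e])
  · rintro ⟨hG, hc⟩
    refine ⟨by exact_mod_cast hG.degree_le, fun β hs hne => ?_, hc⟩
    rw [barF_eq_specPt]
    refine hG.vanishing _ (fun i => by simp) (by exact_mod_cast hs) fun e => hne ?_
    funext i
    exact_mod_cast congrFun e i

theorem existsUnique_isInterpolation {n : ℕ} (α : Fin (n + 1) → ℕ) :
    ∃! G, IsInterpolation α G := by
  obtain ⟨G, hG⟩ := exists_hasType_coeff_eq_one genericParams_FF α
  refine ⟨G, (isInterpolation_iff α G).2 hG, fun G' hG' => ?_⟩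
  replace hG' := (isInterpolation_iff α G').1 hG'
  refine sub_eq_zero.1 (HasType.eq_zero_of_coeff genericParams_FF α _ (hG'.1.sub hG.1) ?_)
  rw [MvPolynomial.coeff_sub, hG.2, hG'.2, sub_self]

lemma isInterpolation_interpG {n : ℕ} (α : Fin (n + 1) → ℕ) : IsInterpolation α (interpG α) :=
  Classical.epsilon_spec (existsUnique_isInterpolation α).exists

/-! ### Polynomial operators -/

/-- The polynomial `p` vanishes at the spectral points of compositions of weight at most `d`. -/
def VanishesUpTo (q t : k) {n : ℕ} (d : ℤ) (p : MvPolynomial (Fin n) k) : Prop :=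
  ∀ w : Fin n → ℤ, (∀ i, 0 ≤ w i) → ∑ i, w i ≤ d → MvPolynomial.eval (specPt q t w) p = 0

lemma HasType.vanishesUpTo {q t : k} {n : ℕ} {v : Fin n → ℤ} {p : MvPolynomial (Fin n) k}
    (hp : HasType q t v p) : VanishesUpTo q t (∑ i, v i - 1) p := by
  intro w hw hs
  refine hp.vanishing w hw (by omega) ?_
  rintro rfl
  omega

lemma exists_dividedDifference {n : ℕ} (i : Fin n) (p : MvPolynomial (Fin (n + 1)) k) :
    ∃ g, MvPolynomial.rename (Equiv.swap i.castSucc i.succ) p - p =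
      (MvPolynomial.X i.castSucc - MvPolynomial.X i.succ) * g := by
  refine dvd_algHom_sub_algHom (MvPolynomial.rename (Equiv.swap i.castSucc i.succ))
    (AlgHom.id k _) _ (fun j => ?_) p
  rw [MvPolynomial.rename_X, AlgHom.id_apply]
  by_cases h1 : j = i.castSucc
  · rw [h1, Equiv.swap_apply_left]
    exact ⟨-1, by ring⟩
  · by_cases h2 : j = i.succ
    · rw [h2, Equiv.swap_apply_right]
    · rw [Equiv.swap_apply_of_ne_of_ne h1 h2, sub_self]
      exact dvd_zero _

/-- The divided difference `(s_i p - p) / (x_i - x_{i+1})`. -/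
def dividedDifference {n : ℕ} (i : Fin n) (p : MvPolynomial (Fin (n + 1)) k) :
    MvPolynomial (Fin (n + 1)) k :=
  (exists_dividedDifference i p).choose

lemma mul_dividedDifference {n : ℕ} (i : Fin n) (p : MvPolynomial (Fin (n + 1)) k) :
    (MvPolynomial.X i.castSucc - MvPolynomial.X i.succ) * dividedDifference i p =
      MvPolynomial.rename (Equiv.swap i.castSucc i.succ) p - p :=
  (exists_dividedDifference i p).choose_spec.symm

/-- The Demazure-Lusztig operator on polynomials. -/
def heckePoly (t : k) {n : ℕ} (i : Fin n) (p : MvPolynomial (Fin (n + 1)) k) :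
    MvPolynomial (Fin (n + 1)) k :=
  MvPolynomial.C t * p +
    (MvPolynomial.X i.castSucc - MvPolynomial.C t * MvPolynomial.X i.succ) * dividedDifference i p

lemma totalDegree_X_sub_X {σ : Type*} {i j : σ} (h : i ≠ j) :
    (MvPolynomial.X i - MvPolynomial.X j : MvPolynomial σ k).totalDegree = 1 := by
  classical
  refine le_antisymm ((MvPolynomial.totalDegree_sub _ _).trans (by simp)) ?_
  refine le_trans ?_ (MvPolynomial.le_totalDegree (s := Finsupp.single i 1) ?_)
  · simp
  · simp [MvPolynomial.coeff_X, Finsupp.single_left_inj, h.symm]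

lemma X_sub_X_ne_zero {σ : Type*} {i j : σ} (h : i ≠ j) :
    (MvPolynomial.X i - MvPolynomial.X j : MvPolynomial σ k) ≠ 0 := by
  intro e
  simpa [e] using totalDegree_X_sub_X (k := k) h

lemma totalDegree_heckePoly_le (t : k) {n : ℕ} (i : Fin n) (p : MvPolynomial (Fin (n + 1)) k) :
    (heckePoly t i p).totalDegree ≤ p.totalDegree := by
  have hne : i.castSucc ≠ i.succ := Fin.castSucc_lt_succ.ne
  refine (MvPolynomial.totalDegree_add _ _).trans (max_le ?_ ?_)
  · exact (MvPolynomial.totalDegree_mul _ _).trans (by simp)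
  · by_cases h0 : dividedDifference i p = 0
    · simp [h0]
    have h1 := congrArg MvPolynomial.totalDegree (mul_dividedDifference i p)
    rw [MvPolynomial.totalDegree_mul_of_isDomain (X_sub_X_ne_zero hne) h0,
      totalDegree_X_sub_X hne] at h1
    have h2 : (MvPolynomial.rename (Equiv.swap i.castSucc i.succ) p - p).totalDegree ≤
        p.totalDegree :=
      (MvPolynomial.totalDegree_sub _ _).trans
        (max_le (MvPolynomial.totalDegree_rename_le _ _) le_rfl)
    have h3 : (MvPolynomial.X i.castSucc - MvPolynomial.C t * MvPolynomial.X i.succ :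
        MvPolynomial (Fin (n + 1)) k).totalDegree ≤ 1 := by
      refine (MvPolynomial.totalDegree_sub _ _).trans (max_le (by simp) ?_)
      exact (MvPolynomial.totalDegree_mul _ _).trans (by simp)
    -- The divided difference has degree at least one below that of p, which compensates for the
    -- linear factor.
    have h4 := MvPolynomial.totalDegree_mul
      (MvPolynomial.X i.castSucc - MvPolynomial.C t * MvPolynomial.X i.succ)
      (dividedDifference i p)
    omega

/-! ### Values of H_i p at points and its effect on vanishing conditions -/

section Evaluation

variable {A : Type*} [CommRing A] [Algebra k A]

/-- Here g is the value of the divided difference; keeping it avoids dividing by z_i - z_{i+1},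
which may be zero or a nonunit. -/
lemma exists_aeval_heckePoly (t : k) {n : ℕ} (i : Fin n) (p : MvPolynomial (Fin (n + 1)) k)
    (z : Fin (n + 1) → A) : ∃ g : A,
      MvPolynomial.aeval z (heckePoly t i p) = algebraMap k A t * MvPolynomial.aeval z p +
        (z i.castSucc - algebraMap k A t * z i.succ) * g ∧
      (z i.castSucc - z i.succ) * g =
        MvPolynomial.aeval (z ∘ Equiv.swap i.castSucc i.succ) p - MvPolynomial.aeval z p := by
  refine ⟨MvPolynomial.aeval z (dividedDifference i p), ?_, ?_⟩
  · simp [heckePoly]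
  · have := congrArg (MvPolynomial.aeval z) (mul_dividedDifference i p)
    simpa [MvPolynomial.aeval_rename] using this

/-- When z_i = 0 the quotient (x_i - t x_{i+1}) / (x_i - x_{i+1}) becomes t, so H_i reduces to t
s_i. -/
lemma aeval_heckePoly_of_eq_zero (t : k) {n : ℕ} (i : Fin n) (p : MvPolynomial (Fin (n + 1)) k)
    (z : Fin (n + 1) → A) (hz : z i.castSucc = 0) :
    MvPolynomial.aeval z (heckePoly t i p) =
      algebraMap k A t * MvPolynomial.aeval (z ∘ Equiv.swap i.castSucc i.succ) p := by
  obtain ⟨g, h1, h2⟩ := exists_aeval_heckePoly t i p z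
  rw [hz] at h1 h2
  rw [h1]
  linear_combination algebraMap k A t * h2

lemma aeval_heckePoly_of_eq_mul (t : k) {n : ℕ} (i : Fin n) (p : MvPolynomial (Fin (n + 1)) k)
    (z : Fin (n + 1) → A) (hz : z i.castSucc = algebraMap k A t * z i.succ) :
    MvPolynomial.aeval z (heckePoly t i p) = algebraMap k A t * MvPolynomial.aeval z p := by
  obtain ⟨g, h1, h2⟩ := exists_aeval_heckePoly t i p z
  rw [h1, hz, sub_self, zero_mul, add_zero]

end Evaluation

/-- The coefficient `(v̄_i - t v̄_{i+1}) / (v̄_i - v̄_{i+1})`. -/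
def heckeCoeff (q t : k) {n : ℕ} (i : Fin n) (v : Fin (n + 1) → ℤ) : k :=
  (specPt q t v i.castSucc - t * specPt q t v i.succ) /
    (specPt q t v i.castSucc - specPt q t v i.succ)

lemma heckeCoeff_eq_zero {q t : k} (ht : t ≠ 0) {n : ℕ} (i : Fin n) (v : Fin (n + 1) → ℤ)
    (h : v i.castSucc = v i.succ) : heckeCoeff q t i v = 0 := by
  rw [heckeCoeff, specPt_castSucc_of_eq ht v i h, sub_self, zero_div]

lemma heckeCoeff_ne_zero {q t : k} (h : GenericParams q t) {n : ℕ} (i : Fin n)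
    (v : Fin (n + 1) → ℤ) (hv : v i.castSucc ≠ v i.succ) : heckeCoeff q t i v ≠ 0 := by
  refine div_ne_zero (fun e => hv ?_) (fun e => hv ?_)
  · exact specPt_eq_imp h v _ _ 1 (by rw [zpow_one]; exact sub_eq_zero.1 e)
  · exact specPt_eq_imp h v _ _ 0 (by rw [zpow_zero, one_mul]; exact sub_eq_zero.1 e)

lemma eval_heckePoly {q t : k} (h : GenericParams q t) {n : ℕ} (i : Fin n)
    (p : MvPolynomial (Fin (n + 1)) k) (v : Fin (n + 1) → ℤ) :
    MvPolynomial.eval (specPt q t v) (heckePoly t i p) =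
      t * MvPolynomial.eval (specPt q t v) p + heckeCoeff q t i v *
        (MvPolynomial.eval (specPt q t (swapEntries i v)) p -
          MvPolynomial.eval (specPt q t v) p) := by
  -- For equal entries the spectral point is not symmetric under s_i, but v̄_i = t v̄_{i+1} kills
  -- the divided difference term.
  by_cases hv : v i.castSucc = v i.succ
  · have := aeval_heckePoly_of_eq_mul t i p (specPt q t v) (specPt_castSucc_of_eq h.t_ne_zero v i hv)
    rw [heckeCoeff_eq_zero h.t_ne_zero i v hv, zero_mul, add_zero]
    simpa [MvPolynomial.aeval_eq_eval] using this
  · obtain ⟨g, h1, h2⟩ := exists_aeval_heckePoly t i p (specPt q t v)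
    simp only [MvPolynomial.aeval_eq_eval, Algebra.algebraMap_self, RingHom.id_apply] at h1 h2
    rw [specPt_swapEntries v i hv, h1, ← h2, heckeCoeff]
    have : specPt q t v i.castSucc - specPt q t v i.succ ≠ 0 := fun e => hv
      (specPt_eq_imp h v _ _ 0 (by rw [zpow_zero, one_mul]; exact sub_eq_zero.1 e))
    field_simp

lemma sum_swapEntries {n : ℕ} (i : Fin n) (v : Fin (n + 1) → ℤ) :
    ∑ j, swapEntries i v j = ∑ j, v j :=
  Equiv.sum_comp (Equiv.swap i.castSucc i.succ) v

lemma swapEntries_swapEntries {n : ℕ} (i : Fin n) (v : Fin (n + 1) → ℤ) :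
    swapEntries i (swapEntries i v) = v := by
  funext j
  simp [swapEntries]

lemma VanishesUpTo.heckePoly {q t : k} (h : GenericParams q t) {n : ℕ} {d : ℤ} (i : Fin n)
    {p : MvPolynomial (Fin (n + 1)) k} (hp : VanishesUpTo q t d p) :
    VanishesUpTo q t d (heckePoly t i p) := by
  intro w hw hs
  rw [eval_heckePoly h, hp w hw hs, hp (swapEntries i w) (fun j => hw _) (by rwa [sum_swapEntries])]
  ring

/-- The operator `Φ` on polynomials. -/
def phiPoly (q t : k) {n : ℕ} (p : MvPolynomial (Fin (n + 1)) k) :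
    MvPolynomial (Fin (n + 1)) k :=
  (MvPolynomial.X (Fin.last n) - MvPolynomial.C (t ^ (-(n : ℤ)))) *
    MvPolynomial.aeval (Fin.cons (α := fun _ => MvPolynomial (Fin (n + 1)) k)
      (MvPolynomial.C q⁻¹ * MvPolynomial.X (Fin.last n))
      fun i : Fin n => MvPolynomial.X i.castSucc) p

lemma totalDegree_phiPoly_le (q t : k) {n : ℕ} (p : MvPolynomial (Fin (n + 1)) k) :
    (phiPoly q t p).totalDegree ≤ p.totalDegree + 1 := by
  refine (MvPolynomial.totalDegree_mul _ _).trans ?_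
  rw [totalDegree_X_sub_C, add_comm]
  gcongr
  refine totalDegree_aeval_le _ (fun i => ?_) p
  refine Fin.cases ?_ (fun i => ?_) i
  · exact (MvPolynomial.totalDegree_mul _ _).trans (by simp)
  · simp

lemma aeval_phiPoly {A : Type*} [CommRing A] [Algebra k A] {q : k} (t : k) (hq : q ≠ 0) {n : ℕ}
    (p : MvPolynomial (Fin (n + 1)) k) (z : Fin (n + 1) → A) :
    MvPolynomial.aeval (rotate (algebraMap k A q * ·) z) (phiPoly q t p) =
      (algebraMap k A q * z 0 - algebraMap k A (t ^ (-(n : ℤ)))) * MvPolynomial.aeval z p := by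
  rw [phiPoly, map_mul]
  congr 1
  · simp [rotate]
  · rw [← AlgHom.comp_apply]
    congr 1
    ext i
    refine Fin.cases ?_ (fun i => ?_) i
    · rw [AlgHom.comp_apply, MvPolynomial.aeval_X, Fin.cons_zero, map_mul, MvPolynomial.aeval_C,
        MvPolynomial.aeval_X, rotate, Fin.snoc_last, ← mul_assoc, ← map_mul, inv_mul_cancel₀ hq,
        map_one, one_mul, MvPolynomial.aeval_X]
    · simp [rotate, Fin.tail]

lemma eval_phiPoly_natVec {q t : k} (hq : q ≠ 0) {n : ℕ} (p : MvPolynomial (Fin (n + 1)) k)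
    (v : Fin (n + 1) → ℤ) :
    MvPolynomial.eval (specPt q t (natVec v)) (phiPoly q t p) =
      (q * specPt q t v 0 - t ^ (-(n : ℤ))) * MvPolynomial.eval (specPt q t v) p := by
  rw [specPt_natVec hq]
  simpa [MvPolynomial.aeval_eq_eval] using aeval_phiPoly t hq p (specPt q t v)

lemma eval_phiPoly_of_last_eq_zero {q t : k} {n : ℕ} (p : MvPolynomial (Fin (n + 1)) k)
    (v : Fin (n + 1) → ℤ) (hv : ∀ i, 0 ≤ v i) (h0 : v (Fin.last n) = 0) :
    MvPolynomial.eval (specPt q t v) (phiPoly q t p) = 0 := by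
  have hv' : v = Fin.snoc (α := fun _ => ℤ) (Fin.init v) 0 := by rw [← h0, Fin.snoc_init_self]
  rw [hv', specPt_snoc (Fin.init v) (fun i => hv _), phiPoly]
  simp

lemma VanishesUpTo.phiPoly {q t : k} (hq : q ≠ 0) {n : ℕ} {d : ℤ}
    {p : MvPolynomial (Fin (n + 1)) k} (hp : VanishesUpTo q t d p) :
    VanishesUpTo q t (d + 1) (phiPoly q t p) := by
  intro w hw hs
  by_cases h0 : w (Fin.last n) = 0
  · exact eval_phiPoly_of_last_eq_zero p w hw h0
  · rw [← natVec_sharpVec w, eval_phiPoly_natVec hq, hp, mul_zero]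
    · intro i
      refine Fin.cases ?_ (fun i => ?_) i
      · have := hw (Fin.last n)
        simp only [sharpVec, Fin.cons_zero]
        omega
      · simpa [sharpVec, Fin.init] using hw _
    · have := sum_natVec (sharpVec w)
      rw [natVec_sharpVec] at this
      omega

/-- The factor x_N - t^(1-N) takes care of compositions ending in 0; any other composition is u^♮,
where Φ p is a multiple of p(ū). -/
lemma HasType.phiPoly_natVec {q t : k} (hq : q ≠ 0) {n : ℕ} {v : Fin (n + 1) → ℤ}
    {p : MvPolynomial (Fin (n + 1)) k} (hp : HasType q t v p) :
    HasType q t (natVec v) (phiPoly q t p) := by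
  refine ⟨?_, fun w hw hs hne => ?_⟩
  · have h1 := totalDegree_phiPoly_le q t p
    have h2 := hp.degree_le
    rw [sum_natVec]
    omega
  · by_cases h0 : w (Fin.last n) = 0
    · exact eval_phiPoly_of_last_eq_zero p w hw h0
    · rw [← natVec_sharpVec w, eval_phiPoly_natVec hq, hp.vanishing, mul_zero]
      · intro i
        refine Fin.cases ?_ (fun i => ?_) i
        · have := hw (Fin.last n)
          simp only [sharpVec, Fin.cons_zero]
          omega
        · simpa [sharpVec, Fin.init] using hw _
      · have := sum_natVec (sharpVec w)
        rw [natVec_sharpVec] at this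
        rw [sum_natVec] at hs
        omega
      · intro e
        exact hne (by rw [← e, natVec_sharpVec])

/-- Subtracting a suitable multiple of `p` from `H_i p` turns type `v` into type `s_i v`. -/
lemma HasType.heckePoly_sub {q t : k} (h : GenericParams q t) {n : ℕ} (i : Fin n)
    {v : Fin (n + 1) → ℤ} {p : MvPolynomial (Fin (n + 1)) k} (hp : HasType q t v p) :
    HasType q t (swapEntries i v)
      (heckePoly t i p - MvPolynomial.C (t - heckeCoeff q t i v) * p) := by
  refine ⟨?_, fun w hw hs hne => ?_⟩
  · have h1 := totalDegree_heckePoly_le t i p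
    have h2 := (hp.C_mul (t - heckeCoeff q t i v)).degree_le
    have h3 := hp.degree_le
    have h4 := MvPolynomial.totalDegree_sub (heckePoly t i p)
      (MvPolynomial.C (t - heckeCoeff q t i v) * p)
    rw [sum_swapEntries]
    rcases le_max_iff.1 h4 with h5 | h5 <;> omega
  · rw [sum_swapEntries] at hs
    have h1 : MvPolynomial.eval (specPt q t (swapEntries i w)) p = 0 := by
      refine hp.vanishing _ (fun j => hw _) (by rwa [sum_swapEntries]) fun e => hne ?_
      rw [← e, swapEntries_swapEntries]
    rw [map_sub, map_mul, MvPolynomial.eval_C, eval_heckePoly h, h1]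
    by_cases hwv : w = v
    · rw [hwv]
      ring
    · rw [hp.vanishing w hw hs hwv]
      ring

/-! ### Ordered products of operators -/

lemma filter_le_finRange {n : ℕ} (i : Fin n) :
    (List.finRange n).filter (fun j => decide (i ≤ j)) =
      i :: (List.finRange n).filter fun j => decide (i < j) := by
  induction n with
  | zero => exact i.elim0
  | succ n ih =>
    rw [List.finRange_succ]
    refine Fin.cases ?_ (fun i => ?_) i
    · simp [List.filter_map, Function.comp_def]
    · simp [List.filter_map, Function.comp_def, ih]

lemma filter_finRange_le {n : ℕ} (i : Fin n) :
    (List.finRange n).filter (fun j => decide (j ≤ i)) =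
      (List.finRange n).filter (fun j => decide (j < i)) ++ [i] := by
  induction n with
  | zero => exact i.elim0
  | succ n ih =>
    rw [List.finRange_succ]
    refine Fin.cases ?_ (fun i => ?_) i
    · simp [List.filter_map, Function.comp_def]
    · simp [List.filter_map, Function.comp_def, ih]

lemma HFrom_last (n : ℕ) : HFrom n (Fin.last n) = 1 := by
  rw [HFrom, List.filter_eq_nil_iff.2]
  · rfl
  · intro i _
    simp [(Fin.castSucc_lt_last i).not_ge]

lemma HFrom_castSucc {n : ℕ} (i : Fin n) : HFrom n i.castSucc = HOp n i * HFrom n i.succ := by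
  have h1 : ∀ j : Fin n, decide (i.castSucc ≤ j.castSucc) = decide (i ≤ j) := fun j => by simp
  have h2 : ∀ j : Fin n, decide (i.succ ≤ j.castSucc) = decide (i < j) := fun j => by
    simp only [decide_eq_decide, Fin.le_def, Fin.lt_def, Fin.val_succ, Fin.val_castSucc]; omega
  simp only [HFrom, h1, h2]
  rw [filter_le_finRange, List.map_cons, List.prod_cons]

lemma HUpTo_zero (n : ℕ) : HUpTo n 0 = 1 := by
  simp [HUpTo]

lemma HUpTo_succ {n : ℕ} (i : Fin n) : HUpTo n i.succ = HUpTo n i.castSucc * HOp n i := by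
  have h1 : ∀ j : Fin n, decide (j.castSucc < i.castSucc) = decide (j < i) := fun j => by simp
  have h2 : ∀ j : Fin n, decide (j.castSucc < i.succ) = decide (j ≤ i) := fun j => by
    simp only [decide_eq_decide, Fin.le_def, Fin.lt_def, Fin.val_succ, Fin.val_castSucc]; omega
  simp only [HUpTo, h1, h2]
  rw [filter_finRange_le, List.map_append, List.prod_append, List.map_singleton,
    List.prod_singleton]

/-! ### Action of the operators on polynomials -/

lemma xvar_injective (n : ℕ) : Function.Injective (xvar n) := by
  intro i j h
  exact MvPolynomial.X_injective (IsFractionRing.injective (KPoly n) (KRat n) h)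

lemma xvar_ne_zero (n : ℕ) (j : Fin (n + 1)) : xvar n j ≠ 0 := by
  intro h
  exact MvPolynomial.X_ne_zero j
    (IsFractionRing.injective (KPoly n) (KRat n) (h.trans (map_zero _).symm))

lemma algebraMap_KRat_C {n : ℕ} (c : KK) :
    algebraMap (KPoly n) (KRat n) (MvPolynomial.C c) = algebraMap KK (KRat n) c := by
  rw [IsScalarTower.algebraMap_apply KK (KPoly n) (KRat n), MvPolynomial.algebraMap_eq]

lemma swapVars_algebraMap {n : ℕ} (i : Fin n) (p : KPoly n) :
    swapVars n i (algebraMap (KPoly n) (KRat n) p) =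
      algebraMap (KPoly n) (KRat n) (MvPolynomial.rename (Equiv.swap i.castSucc i.succ) p) := by
  rw [swapVars, IsFractionRing.fieldEquivOfAlgEquiv_algebraMap]
  rfl

lemma HOp_apply {n : ℕ} (i : Fin n) (f : KRat n) :
    HOp n i f = algebraMap KK (KRat n) tK * f +
      (xvar n i.castSucc - algebraMap KK (KRat n) tK * xvar n i.succ) /
        (xvar n i.castSucc - xvar n i.succ) * (swapVars n i f - f) := by
  simp [HOp, mulOp, Algebra.smul_def]

lemma HOp_algebraMap {n : ℕ} (i : Fin n) (p : KPoly n) :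
    HOp n i (algebraMap (KPoly n) (KRat n) p) =
      algebraMap (KPoly n) (KRat n) (heckePoly tK i p) := by
  have hne : xvar n i.castSucc - xvar n i.succ ≠ 0 :=
    sub_ne_zero.2 fun e => Fin.castSucc_lt_succ.ne (xvar_injective n e)
  rw [HOp_apply, swapVars_algebraMap, ← map_sub, ← mul_dividedDifference, heckePoly]
  simp only [map_add, map_mul, map_sub, algebraMap_KRat_C]
  rw [← xvar, ← xvar]
  field_simp

lemma PhiOp_apply {n : ℕ} (f : KRat n) :
    PhiOp n f = (xvar n (Fin.last n) - algebraMap KK (KRat n) (tK ^ (-(n : ℤ)))) *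
      Delta n f := by
  simp [PhiOp, mulOp]

lemma Delta_algebraMap {n : ℕ} (p : KPoly n) :
    Delta n (algebraMap (KPoly n) (KRat n) p) =
      algebraMap (KPoly n) (KRat n) (deltaPoly n p) := by
  rw [Delta, IsFractionRing.fieldEquivOfAlgEquiv_algebraMap]

lemma PhiOp_algebraMap {n : ℕ} (p : KPoly n) :
    PhiOp n (algebraMap (KPoly n) (KRat n) p) =
      algebraMap (KPoly n) (KRat n) (phiPoly qK tK p) := by
  rw [PhiOp_apply, Delta_algebraMap, phiPoly, map_mul, map_sub, algebraMap_KRat_C]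
  rfl

lemma aTau_castSucc {n : ℕ} (i : Fin n) : aTau n i.castSucc = tK * aTau n i.succ := by
  simp only [aTau, Fin.val_castSucc, Fin.val_succ]
  rw [mul_left_comm, ← zpow_one_add₀ genericParams_KK.t_ne_zero]
  congr 2
  push_cast
  ring

lemma eval_aTau_heckePoly {n : ℕ} (i : Fin n) (p : KPoly n) :
    MvPolynomial.eval (aTau n) (heckePoly tK i p) = tK * MvPolynomial.eval (aTau n) p := by
  simpa [MvPolynomial.aeval_eq_eval] using
    aeval_heckePoly_of_eq_mul tK i p (aTau n) (aTau_castSucc i)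

lemma insertNth_castSucc_comp_swap {A : Type*} {n : ℕ} (i : Fin n) (a : A) (y : Fin n → A) :
    Fin.insertNth (α := fun _ => A) i.castSucc a y ∘ Equiv.swap i.castSucc i.succ =
      Fin.insertNth (α := fun _ => A) i.succ a y := by
  funext j
  refine Fin.succAboveCases i.succ ?_ (fun l => ?_) j
  · simp
  · rw [Function.comp, Fin.insertNth_apply_succAbove]
    by_cases hl : l = i
    · subst hl
      rw [Fin.succAbove_succ_self, Equiv.swap_apply_left]
      conv_lhs => rw [← Fin.succAbove_castSucc_self l]
      rw [Fin.insertNth_apply_succAbove]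
    · have h1 : i.succ.succAbove l = i.castSucc.succAbove l := by
        rcases lt_or_gt_of_ne hl with h | h
        · rw [Fin.succAbove_of_castSucc_lt _ _ (Fin.castSucc_lt_castSucc_iff.2 h),
            Fin.succAbove_of_castSucc_lt _ _ (lt_trans (Fin.castSucc_lt_castSucc_iff.2 h)
              Fin.castSucc_lt_succ)]
        · rw [Fin.succAbove_of_lt_succ _ _ (lt_trans Fin.castSucc_lt_succ
              (Fin.succ_lt_succ_iff.2 h)),
            Fin.succAbove_of_lt_succ _ _ (Fin.succ_lt_succ_iff.2 h)]
      rw [Equiv.swap_apply_of_ne_of_ne, h1, Fin.insertNth_apply_succAbove]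
      · rw [h1]
        exact Fin.succAbove_ne _ _
      · exact Fin.succAbove_ne _ _

/-- All the stated properties pass through each H_i. In the last one, each H_i acts as t s_i and
moves the zero coordinate one place, so x_j = 0 becomes x_N = 0. -/
lemma exists_HFrom_algebraMap {n : ℕ} (j : Fin (n + 1)) (p : KPoly n) :
    ∃ r : KPoly n, HFrom n j (algebraMap (KPoly n) (KRat n) p) =
        algebraMap (KPoly n) (KRat n) r ∧
      r.totalDegree ≤ p.totalDegree ∧
      (∀ d, VanishesUpTo qK tK d p → VanishesUpTo qK tK d r) ∧
      MvPolynomial.eval (aTau n) r = tK ^ (n - j : ℕ) * MvPolynomial.eval (aTau n) p ∧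
      ∀ y : Fin n → KPoly n, MvPolynomial.aeval (Fin.insertNth (α := fun _ => KPoly n) j 0 y) r =
        MvPolynomial.C (tK ^ (n - j : ℕ)) *
          MvPolynomial.aeval (Fin.snoc (α := fun _ => KPoly n) y 0) p := by
  induction j using Fin.reverseInduction with
  | last =>
    refine ⟨p, by rw [HFrom_last]; rfl, le_rfl, fun d h => h, by simp, fun y => ?_⟩
    rw [Fin.insertNth_last']
    simp
  | cast i ih =>
    obtain ⟨r, h1, h2, h3, h4, h5⟩ := ih
    have hi : n - (i.castSucc : Fin (n + 1)).val = n - (i.succ : Fin (n + 1)).val + 1 := by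
      simp only [Fin.val_castSucc, Fin.val_succ]
      omega
    refine ⟨heckePoly tK i r, ?_, (totalDegree_heckePoly_le _ _ _).trans h2,
      fun d h => (h3 d h).heckePoly genericParams_KK i, ?_, fun y => ?_⟩
    · rw [HFrom_castSucc, Module.End.mul_apply, h1, HOp_algebraMap]
    · rw [eval_aTau_heckePoly, h4, hi, pow_succ']
      ring
    · rw [aeval_heckePoly_of_eq_zero _ _ _ _ (Fin.insertNth_apply_same _ _ _),
        insertNth_castSucc_comp_swap, h5, hi, pow_succ', MvPolynomial.algebraMap_eq, map_mul]
      ring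

lemma exists_HUpTo_algebraMap {n : ℕ} (j : Fin (n + 1)) (p : KPoly n) :
    ∃ r : KPoly n, HUpTo n j (algebraMap (KPoly n) (KRat n) p) =
        algebraMap (KPoly n) (KRat n) r ∧
      r.totalDegree ≤ p.totalDegree ∧
      (∀ d, VanishesUpTo qK tK d p → VanishesUpTo qK tK d r) ∧
      ∀ y : Fin n → KPoly n, MvPolynomial.aeval (Fin.cons (α := fun _ => KPoly n) 0 y) r =
        MvPolynomial.C (tK ^ (j : ℕ)) *
          MvPolynomial.aeval (Fin.insertNth (α := fun _ => KPoly n) j 0 y) p := by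
  -- The rightmost factor H_i acts first, so the induction hypothesis is needed for H_i p in place
  -- of p.
  induction j using Fin.induction generalizing p with
  | zero =>
    refine ⟨p, by rw [HUpTo_zero]; rfl, le_rfl, fun d h => h, fun y => ?_⟩
    rw [Fin.insertNth_zero']
    simp
  | succ i ih =>
    obtain ⟨r, h1, h2, h3, h4⟩ := ih (heckePoly tK i p)
    refine ⟨r, ?_, h2.trans (totalDegree_heckePoly_le _ _ _),
      fun d h => h3 d (h.heckePoly genericParams_KK i), fun y => ?_⟩
    · rw [HUpTo_succ, Module.End.mul_apply, HOp_algebraMap, h1]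
    · rw [h4, aeval_heckePoly_of_eq_zero _ _ _ _ (Fin.insertNth_apply_same _ _ _),
        insertNth_castSucc_comp_swap, MvPolynomial.algebraMap_eq, Fin.val_castSucc, Fin.val_succ,
        pow_succ, map_mul]
      ring

/-- At x_j = 0 the three factors contribute t^(n-j), -t^(-n) and t^j (zero-based j), and the
permutations compose to the identity; so r = -p there. -/
lemma exists_cherednik_algebraMap {n : ℕ} (j : Fin (n + 1)) (p : KPoly n) :
    ∃ r : KPoly n, (HFrom n j * PhiOp n * HUpTo n j) (algebraMap (KPoly n) (KRat n) p) =
        algebraMap (KPoly n) (KRat n) r ∧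
      r.totalDegree ≤ p.totalDegree + 1 ∧
      (∀ d, VanishesUpTo qK tK d p → VanishesUpTo qK tK (d + 1) r) ∧
      MvPolynomial.X j ∣ p + r := by
  obtain ⟨r₁, h1, h2, h3, h4⟩ := exists_HUpTo_algebraMap j p
  obtain ⟨r, h5, h6, h7, -, h8⟩ := exists_HFrom_algebraMap j (phiPoly qK tK r₁)
  refine ⟨r, ?_, ?_, fun d h => h7 _ ((h3 d h).phiPoly qK_ne_zero), ?_⟩
  · rw [Module.End.mul_apply, Module.End.mul_apply, h1, PhiOp_algebraMap, h5]
  · exact h6.trans ((totalDegree_phiPoly_le _ _ _).trans (by omega))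
  · let y : Fin n → KPoly n := fun i => MvPolynomial.X (j.succAbove i)
    have hd := dvd_algHom_sub_algHom (AlgHom.id KK (KPoly n))
      (MvPolynomial.aeval (Fin.insertNth (α := fun _ => KPoly n) j 0 y)) (MvPolynomial.X j)
      (fun i => by
        refine Fin.succAboveCases j ?_ (fun l => ?_) i
        · simp
        · simp [y]) (p + r)
    -- Rotation multiplies the moved coordinate by q, which is invisible because that coordinate is
    -- 0.
    have hrot : Fin.snoc (α := fun _ => KPoly n) y 0 =
        rotate (algebraMap KK (KPoly n) qK * ·) (Fin.cons (α := fun _ => KPoly n) 0 y) := by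
      simp [rotate]
    have h9 : MvPolynomial.aeval (Fin.insertNth (α := fun _ => KPoly n) j 0 y) (p + r) = 0 := by
      rw [map_add, h8, hrot, aeval_phiPoly tK qK_ne_zero, h4, Fin.cons_zero, mul_zero, zero_sub,
        MvPolynomial.algebraMap_eq, ← mul_assoc, mul_neg, ← MvPolynomial.C_mul, neg_mul,
        ← mul_assoc, ← MvPolynomial.C_mul]
      have : tK ^ (n - j : ℕ) * tK ^ (-(n : ℤ)) * tK ^ (j : ℕ) = 1 := by
        rw [← zpow_natCast, ← zpow_natCast, ← zpow_add₀ genericParams_KK.t_ne_zero,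
          ← zpow_add₀ genericParams_KK.t_ne_zero]
        have hj := j.is_le
        rw [Nat.cast_sub hj, show (n : ℤ) - (j : ℕ) + -n + (j : ℕ) = 0 by ring, zpow_zero]
      rw [this]
      simp
    rwa [h9, sub_zero, AlgHom.id_apply] at hd

lemma XiOp_apply {n : ℕ} (j : Fin (n + 1)) (f : KRat n) :
    XiOp n j f = (xvar n j)⁻¹ * (f + (HFrom n j * PhiOp n * HUpTo n j) f) := by
  simp [XiOp, mulOp, mul_add]

/-- Polynomials of type `v` are eigenfunctions of the inhomogeneous Cherednik operators. -/
theorem HasType.cherednik_apply {n : ℕ} {v : Fin (n + 1) → ℤ} {p : KPoly n}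
    (hp : HasType qK tK v p) (j : Fin (n + 1)) :
    (HFrom n j * PhiOp n * HUpTo n j) (algebraMap (KPoly n) (KRat n) p) =
      algebraMap (KPoly n) (KRat n)
        ((MvPolynomial.X j * MvPolynomial.C (specPt qK tK v j)⁻¹ - 1) * p) := by
  obtain ⟨r, h1, h2, h3, g, h4⟩ := exists_cherednik_algebraMap j p
  have hg : g = MvPolynomial.C (specPt qK tK v j)⁻¹ * p := by
    have hdeg : g.totalDegree ≤ p.totalDegree := by
      by_cases hg0 : g = 0
      · simp [hg0]
      have h5 := congrArg MvPolynomial.totalDegree h4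
      rw [MvPolynomial.totalDegree_mul_of_isDomain (MvPolynomial.X_ne_zero j) hg0,
        MvPolynomial.totalDegree_X] at h5
      have h6 := MvPolynomial.totalDegree_add p r
      rcases le_max_iff.1 h6 with h | h <;> omega
    -- As p vanishes in weights below |v| and Φ gains one level, r vanishes in all weights up to
    -- |v|; only p survives in x_j g = p + r.
    have hev : ∀ w : Fin (n + 1) → ℤ, (∀ i, 0 ≤ w i) → ∑ i, w i ≤ ∑ i, v i →
        specPt qK tK w j * MvPolynomial.eval (specPt qK tK w) g =
          MvPolynomial.eval (specPt qK tK w) p := by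
      intro w hw hs
      have h5 := congrArg (MvPolynomial.eval (specPt qK tK w)) h4
      rw [map_add, h3 _ hp.vanishesUpTo w hw (by omega), add_zero, map_mul,
        MvPolynomial.eval_X] at h5
      exact h5.symm
    have hgt : HasType qK tK v g := by
      refine ⟨?_, fun w hw hs hne => ?_⟩
      · have := hp.degree_le
        omega
      · have h5 := hev w hw hs
        rw [hp.vanishing w hw hs hne] at h5
        exact (mul_eq_zero.1 h5).resolve_left (specPt_ne_zero genericParams_KK w j)
    by_cases hv : ∀ i, 0 ≤ v i
    · refine sub_eq_zero.1 ((hgt.sub (hp.C_mul _)).eq_zero genericParams_KK ?_)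
      rw [map_sub, map_mul, MvPolynomial.eval_C, ← hev v hv le_rfl, inv_mul_cancel_left₀
        (specPt_ne_zero genericParams_KK v j), sub_self]
    -- If v has a negative entry, type v imposes vanishing at every composition of weight at most
    -- |v|, so both polynomials are zero.
    · have hz : ∀ p' : KPoly n, HasType qK tK v p' → p' = 0 := by
        intro p' hp'
        refine eq_zero_of_vanishing genericParams_KK p' (∑ i, v i).toNat ?_ fun w hw hs => ?_
        · have := hp'.degree_le
          omega
        · refine hp'.vanishing w hw ?_ fun e => hv (e ▸ hw)
          have := hp'.degree_le
          omega
      rw [hz g hgt, hz p hp, mul_zero]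
  have hr : r = (MvPolynomial.X j * MvPolynomial.C (specPt qK tK v j)⁻¹ - 1) * p := by
    rw [hg] at h4
    linear_combination h4
  rw [h1, hr]

theorem HasType.XiOp_apply {n : ℕ} {v : Fin (n + 1) → ℤ} {p : KPoly n}
    (hp : HasType qK tK v p) (j : Fin (n + 1)) :
    XiOp n j (algebraMap (KPoly n) (KRat n) p) =
      algebraMap KK (KRat n) (specPt qK tK v j)⁻¹ * algebraMap (KPoly n) (KRat n) p := by
  rw [InterpolationMacdonald.XiOp_apply, hp.cherednik_apply, ← map_add,
    show p + (MvPolynomial.X j * MvPolynomial.C (specPt qK tK v j)⁻¹ - 1) * p =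
      MvPolynomial.X j * (MvPolynomial.C (specPt qK tK v j)⁻¹ * p) by ring,
    map_mul, ← xvar, inv_mul_cancel_left₀ (xvar_ne_zero n j), map_mul, algebraMap_KRat_C]

/-- The first Cherednik relation reads H_1 ⋯ H_{N-1} Φ p = (x_1 / v̄_1 - 1) p; at aτ the product of
the H_i becomes t^(N-1) and x_1 becomes a. -/
lemma HasType.eval_aTau_phiPoly {n : ℕ} {v : Fin (n + 1) → ℤ} {p : KPoly n}
    (hp : HasType qK tK v p) :
    MvPolynomial.eval (aTau n) (phiPoly qK tK p) =
      tK ^ (-(n : ℤ)) * (aK * (specPt qK tK v 0)⁻¹ - 1) * MvPolynomial.eval (aTau n) p := by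
  obtain ⟨r, h1, -, -, h2, -⟩ := exists_HFrom_algebraMap 0 (phiPoly qK tK p)
  have h3 := hp.cherednik_apply 0
  rw [HUpTo_zero, mul_one, Module.End.mul_apply, PhiOp_algebraMap, h1] at h3
  have h4 := IsFractionRing.injective (KPoly n) (KRat n) h3
  rw [h4] at h2
  simp only [map_mul, map_sub, MvPolynomial.eval_X, MvPolynomial.eval_C, map_one, Fin.val_zero,
    Nat.sub_zero] at h2
  have h5 : aTau n 0 = aK := by simp [aTau]
  have ht := genericParams_KK.t_ne_zero
  rw [h5] at h2
  rw [mul_assoc, h2, ← mul_assoc, ← zpow_natCast, ← zpow_add₀ ht, neg_add_cancel, zpow_zero,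
    one_mul]

/-! ### Nonvanishing at `aτ` -/

lemma nonneg_induction {n : ℕ} {P : (Fin (n + 1) → ℤ) → Prop} (h0 : P fun _ => 0)
    (hs : ∀ (i : Fin n) (v : Fin (n + 1) → ℤ), (∀ j, 0 ≤ v j) → v i.castSucc ≠ v i.succ →
      P v → P (swapEntries i v))
    (hn : ∀ v : Fin (n + 1) → ℤ, (∀ j, 0 ≤ v j) → P v → P (natVec v)) :
    ∀ v : Fin (n + 1) → ℤ, (∀ j, 0 ≤ v j) → P v := by
  have key : ∀ (d : ℕ) (v : Fin (n + 1) → ℤ), (∀ j, 0 ≤ v j) → ∑ j, v j = d → P v := by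
    intro d
    induction d with
    | zero =>
      intro v hv hd
      have : v = fun _ => 0 := by
        funext j
        exact (Finset.sum_eq_zero_iff_of_nonneg fun j _ => hv j).1 hd j (Finset.mem_univ j)
      rwa [this]
    | succ d ih =>
      -- A positive entry is moved to the last place by exchanges of unequal neighbours; then v is
      -- u^♮ with u of smaller weight.
      have aux : ∀ (j : Fin (n + 1)) (v : Fin (n + 1) → ℤ), (∀ j, 0 ≤ v j) →
          ∑ j, v j = (d + 1 : ℕ) → 0 < v j → P v := by
        intro j
        induction j using Fin.reverseInduction with
        | last =>
          intro v hv hd hj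
          have hsh : ∀ i, 0 ≤ sharpVec v i := by
            intro i
            refine Fin.cases ?_ (fun i => ?_) i
            · simp only [sharpVec, Fin.cons_zero]
              omega
            · simpa [sharpVec, Fin.init] using hv _
          have hsum := sum_natVec (sharpVec v)
          rw [natVec_sharpVec] at hsum
          rw [← natVec_sharpVec v]
          refine hn _ hsh (ih _ hsh ?_)
          push_cast at hd
          omega
        | cast i ihj =>
          intro v hv hd hj
          by_cases he : v i.castSucc = v i.succ
          · exact ihj v hv hd (he ▸ hj)
          · rw [← swapEntries_swapEntries i v]
            refine hs i _ (fun j => hv _) ?_ (ihj _ (fun j => hv _) ?_ ?_)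
            · simpa [swapEntries] using Ne.symm he
            · rw [sum_swapEntries, hd]
            · simpa [swapEntries] using hj
      intro v hv hd
      by_contra hP
      have hz : ∑ j, v j = 0 := Finset.sum_eq_zero fun j _ =>
        le_antisymm (not_lt.1 fun hj => hP (aux j v hv hd hj)) (hv j)
      omega
  intro v hv
  exact key (∑ j, v j).toNat v hv (Int.toNat_of_nonneg (Finset.sum_nonneg fun j _ => hv j)).symm

lemma specPt_qK {n : ℕ} (v : Fin n → ℤ) :
    specPt qK tK v = algebraMap FF KK ∘ specPt qF tF v := by
  funext i
  simp only [specPt, Function.comp, map_mul, map_zpow₀]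
  rfl

lemma aK_ne_algebraMap (x : FF) : aK ≠ algebraMap FF KK x := by
  intro h
  have h1 : algebraMap (Polynomial FF) KK Polynomial.X =
      algebraMap (Polynomial FF) KK (Polynomial.C x) := by
    rw [RatFunc.algebraMap_X, RatFunc.algebraMap_C]
    exact h
  exact Polynomial.X_ne_C x (RatFunc.algebraMap_injective FF h1)

lemma aK_mul_inv_specPt_sub_one_ne_zero {n : ℕ} (v : Fin n → ℤ) (i : Fin n) :
    aK * (specPt qK tK v i)⁻¹ - 1 ≠ 0 := by
  intro h
  have h1 := specPt_ne_zero genericParams_KK v i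
  have h2 : aK = specPt qK tK v i := by
    field_simp at h
    linear_combination h
  exact aK_ne_algebraMap (specPt qF tF v i) (by rw [h2, specPt_qK]; rfl)

/-- Exchanging unequal neighbours multiplies the value at aτ by a nonzero Hecke coefficient, and Φ
multiplies it by t^(1-N) (a v̄_1⁻¹ - 1), nonzero because a is transcendental over 𝔽. -/
lemma exists_hasType_eval_aTau_ne_zero {n : ℕ} : ∀ v : Fin (n + 1) → ℤ, (∀ j, 0 ≤ v j) →
    ∃ p : KPoly n, HasType qK tK v p ∧ MvPolynomial.eval (aTau n) p ≠ 0 := by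
  refine nonneg_induction ?_ ?_ ?_
  · refine ⟨1, ⟨by simp, fun w hw hs hne => ?_⟩, by simp⟩
    refine absurd ?_ hne
    have hz : ∑ j, w j = 0 := le_antisymm (by simpa using hs) (Finset.sum_nonneg fun j _ => hw j)
    funext j
    exact (Finset.sum_eq_zero_iff_of_nonneg fun j _ => hw j).1 hz j (Finset.mem_univ j)
  · rintro i v hv hne ⟨p, hp, h0⟩
    refine ⟨_, hp.heckePoly_sub genericParams_KK i, ?_⟩
    rw [map_sub, map_mul, eval_aTau_heckePoly, MvPolynomial.eval_C, ← sub_mul, sub_sub_cancel]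
    exact mul_ne_zero (heckeCoeff_ne_zero genericParams_KK i v hne) h0
  · rintro v hv ⟨p, hp, h0⟩
    refine ⟨_, hp.phiPoly_natVec qK_ne_zero, ?_⟩
    rw [hp.eval_aTau_phiPoly]
    exact mul_ne_zero (mul_ne_zero (zpow_ne_zero _ genericParams_KK.t_ne_zero)
      (aK_mul_inv_specPt_sub_one_ne_zero v 0)) h0

lemma hasType_interpGK {n : ℕ} (α : Fin (n + 1) → ℕ) :
    HasType qK tK (fun i => (α i : ℤ)) (interpGK α) := by
  have h := ((isInterpolation_iff α _).1 (isInterpolation_interpG α)).1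
  refine ⟨?_, fun w hw hs hne => ?_⟩
  · have h1 := h.degree_le
    have h2 : (interpGK α).totalDegree ≤ (interpG α).totalDegree :=
      Finset.sup_mono
        (MvPolynomial.support_map_subset (algebraMap FF KK) (interpG α))
    omega
  · rw [interpGK, specPt_qK, MvPolynomial.eval_map, ← MvPolynomial.eval₂_comp]
    exact (congrArg _ (h.vanishing w hw hs hne)).trans (map_zero _)

lemma interpGK_ne_zero {n : ℕ} (α : Fin (n + 1) → ℕ) : interpGK α ≠ 0 := by
  intro h
  have := congrArg (MvPolynomial.coeff (Finsupp.equivFunOnFinite.symm α)) h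
  rw [interpGK, MvPolynomial.coeff_map, (isInterpolation_interpG α).coeff_eq_one] at this
  simp at this

theorem evalG_ne_zero {n : ℕ} (α : Fin (n + 1) → ℕ) : evalG α ≠ 0 := by
  obtain ⟨p, hp, h0⟩ := exists_hasType_eval_aTau_ne_zero (fun i => (α i : ℤ)) (fun i => by simp)
  obtain ⟨c, rfl⟩ := hp.eq_C_mul genericParams_KK (hasType_interpGK α) (interpGK_ne_zero α)
  rw [map_mul] at h0
  exact right_ne_zero_of_mul h0

/-! ### The identities for compositions -/

/-- The polynomial `K_v` for a composition `v`, regarded as an integral vector. -/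
def Kint {n : ℕ} (v : Fin (n + 1) → ℤ) : KPoly n := Kpoly fun i => (v i).toNat

lemma hasType_Kint {n : ℕ} {v : Fin (n + 1) → ℤ} (hv : ∀ i, 0 ≤ v i) :
    HasType qK tK v (Kint v) := by
  have h := (hasType_interpGK fun i => (v i).toNat).C_mul (evalG fun i => (v i).toNat)⁻¹
  have e : (fun i => ((v i).toNat : ℤ)) = v := funext fun i => Int.toNat_of_nonneg (hv i)
  rwa [e] at h

lemma eval_aTau_Kint {n : ℕ} (v : Fin (n + 1) → ℤ) :
    MvPolynomial.eval (aTau n) (Kint v) = 1 := by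
  rw [Kint, Kpoly, map_mul, MvPolynomial.eval_C]
  exact inv_mul_cancel₀ (evalG_ne_zero _)

lemma HasType.eq_Kint {n : ℕ} {v : Fin (n + 1) → ℤ} (hv : ∀ i, 0 ≤ v i) {p : KPoly n}
    (hp : HasType qK tK v p) : p = MvPolynomial.C (MvPolynomial.eval (aTau n) p) * Kint v := by
  have h0 : Kint v ≠ 0 := fun e => by simpa [e] using eval_aTau_Kint v
  obtain ⟨c, rfl⟩ := hp.eq_C_mul genericParams_KK (hasType_Kint hv) h0
  rw [map_mul, MvPolynomial.eval_C, eval_aTau_Kint, mul_one]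

theorem heckePoly_Kint {n : ℕ} (i : Fin n) {v : Fin (n + 1) → ℤ} (hv : ∀ i, 0 ≤ v i) :
    heckePoly tK i (Kint v) = MvPolynomial.C (tK - heckeCoeff qK tK i v) * Kint v +
      MvPolynomial.C (heckeCoeff qK tK i v) * Kint (swapEntries i v) := by
  have h := ((hasType_Kint hv).heckePoly_sub genericParams_KK i).eq_Kint fun j => hv _
  have e : MvPolynomial.eval (aTau n) (heckePoly tK i (Kint v) -
      MvPolynomial.C (tK - heckeCoeff qK tK i v) * Kint v) = heckeCoeff qK tK i v := by
    rw [map_sub, map_mul, eval_aTau_heckePoly, MvPolynomial.eval_C, eval_aTau_Kint, mul_one,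
      mul_one, sub_sub_cancel]
  rw [e] at h
  exact (sub_eq_iff_eq_add'.1 h)

/-- The coefficient in the action of `Φ` on `K_v`. -/
def phiCoeff {n : ℕ} (v : Fin (n + 1) → ℤ) : KK :=
  tK ^ (-(n : ℤ)) * (aK * (specPt qK tK v 0)⁻¹ - 1)

theorem phiPoly_Kint {n : ℕ} {v : Fin (n + 1) → ℤ} (hv : ∀ i, 0 ≤ v i) :
    phiPoly qK tK (Kint v) = MvPolynomial.C (phiCoeff v) * Kint (natVec v) := by
  have h := ((hasType_Kint hv).phiPoly_natVec qK_ne_zero).eq_Kint (natVec_nonneg hv)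
  rwa [(hasType_Kint hv).eval_aTau_phiPoly, eval_aTau_Kint, mul_one] at h

/-! ### Independence of the shift -/

/-- With at most N rotations each coordinate wraps around, and meets g, at most once. -/
lemma iterate_rotate {A : Type*} (g : A → A) {n : ℕ} (z : Fin (n + 1) → A) (l : ℕ)
    (hl : l ≤ n + 1) (i : Fin (n + 1)) : (rotate g)^[l] z i =
      if h : i + l < n + 1 then z ⟨i + l, h⟩ else g (z ⟨i + l - (n + 1), by omega⟩) := by
  induction l generalizing i with
  | zero => rw [dif_pos (by simpa using i.is_le)]; rfl
  | succ l ih =>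
    rw [Function.iterate_succ_apply', rotate]
    refine Fin.lastCases ?_ (fun i => ?_) i
    · rw [Fin.snoc_last, ih (by omega), dif_pos (by simp; omega), dif_neg (by simp)]
      congr 2
      ext
      simp
      omega
    · rw [Fin.snoc_castSucc, Fin.tail, ih (by omega)]
      simp only [Fin.val_succ, Fin.val_castSucc, add_assoc, add_comm 1 l]

lemma iterate_rotate_zero {A : Type*} (g : A → A) {n : ℕ} (z : Fin (n + 1) → A)
    (i : Fin (n + 1)) : (rotate g)^[i] z 0 = z i := by
  rw [iterate_rotate g z i i.is_lt.le, dif_pos (by simpa using i.is_le)]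
  congr 1
  ext
  simp

lemma iterate_rotate_full {A : Type*} (g : A → A) {n : ℕ} (z : Fin (n + 1) → A) :
    (rotate g)^[n + 1] z = g ∘ z := by
  funext i
  rw [iterate_rotate g z _ le_rfl, dif_neg (by omega)]
  simp

lemma aeval_iterate_phiPoly {n : ℕ} {A : Type*} [CommRing A] [Algebra KK A] (p : KPoly n)
    (z : Fin (n + 1) → A) (l : ℕ) :
    MvPolynomial.aeval ((rotate (algebraMap KK A qK * ·))^[l] z) ((phiPoly qK tK)^[l] p) =
      (∏ j ∈ Finset.range l, (algebraMap KK A qK * (rotate (algebraMap KK A qK * ·))^[j] z 0 -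
        algebraMap KK A (tK ^ (-(n : ℤ))))) * MvPolynomial.aeval z p := by
  induction l with
  | zero => simp
  | succ l ih =>
    rw [Function.iterate_succ_apply', Function.iterate_succ_apply', aeval_phiPoly _ qK_ne_zero, ih,
      Finset.prod_range_succ]
    ring

lemma phiPoly_C_mul {n : ℕ} (c : KK) (p : KPoly n) :
    phiPoly qK tK (MvPolynomial.C c * p) = MvPolynomial.C c * phiPoly qK tK p := by
  simp only [phiPoly, map_mul, MvPolynomial.aeval_C, MvPolynomial.algebraMap_eq]
  ring

lemma iterate_natVec_nonneg {n : ℕ} {v : Fin (n + 1) → ℤ} (hv : ∀ i, 0 ≤ v i) (l : ℕ) :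
    ∀ i, 0 ≤ natVec^[l] v i := by
  induction l with
  | zero => exact hv
  | succ l ih =>
    rw [Function.iterate_succ_apply']
    exact natVec_nonneg ih

lemma iterate_phiPoly_Kint {n : ℕ} {v : Fin (n + 1) → ℤ} (hv : ∀ i, 0 ≤ v i) (l : ℕ) :
    (phiPoly qK tK)^[l] (Kint v) =
      MvPolynomial.C (∏ j ∈ Finset.range l, phiCoeff (natVec^[j] v)) * Kint (natVec^[l] v) := by
  induction l with
  | zero => simp
  | succ l ih =>
    rw [Function.iterate_succ_apply', ih, phiPoly_C_mul, phiPoly_Kint (iterate_natVec_nonneg hv l),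
      Finset.prod_range_succ, map_mul, Function.iterate_succ_apply']
    ring

lemma specPt_iterate_natVec {n : ℕ} (v : Fin (n + 1) → ℤ) (l : ℕ) :
    specPt qK tK (natVec^[l] v) = (rotate (qK * ·))^[l] (specPt qK tK v) := by
  induction l with
  | zero => rfl
  | succ l ih =>
    rw [Function.iterate_succ_apply', Function.iterate_succ_apply', specPt_natVec qK_ne_zero, ih]

/-- This is Φ^N applied to K_v: N rotations raise every entry of v by 1, multiply every coordinate
by q, and bring each coordinate once to the first place, where it contributes its factor. -/
lemma aeval_Kint_add_one {n : ℕ} {A : Type*} [CommRing A] [Algebra KK A]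
    {v : Fin (n + 1) → ℤ} (hv : ∀ i, 0 ≤ v i) (z : Fin (n + 1) → A) :
    algebraMap KK A (∏ i, (tK ^ (-(n : ℤ)) * (aK * (specPt qK tK v i)⁻¹ - 1))) *
        MvPolynomial.aeval (fun i => algebraMap KK A qK * z i) (Kint fun i => v i + 1) =
      (∏ i, (algebraMap KK A qK * z i - algebraMap KK A (tK ^ (-(n : ℤ))))) *
        MvPolynomial.aeval z (Kint v) := by
  have h := aeval_iterate_phiPoly (Kint v) z (n + 1)
  rw [iterate_phiPoly_Kint hv, iterate_rotate_full, map_mul, MvPolynomial.aeval_C,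
    ← Fin.prod_univ_eq_prod_range, ← Fin.prod_univ_eq_prod_range
      (fun j => algebraMap KK A qK * (rotate (algebraMap KK A qK * ·))^[j] z 0 -
        algebraMap KK A (tK ^ (-(n : ℤ))))] at h
  simp only [iterate_rotate_zero, phiCoeff, specPt_iterate_natVec] at h
  have e : natVec^[n + 1] v = fun i => v i + 1 := iterate_rotate_full (· + 1) v
  rw [e] at h
  exact h

/-! ### The shift factors -/

/-- The product `∏_{j < m} (1 - q ^ j y)` in `𝕂`. -/
def qPochK (y : KK) (m : ℕ) : KK := ∏ j ∈ Finset.range m, (1 - qK ^ j * y)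

lemma qPoch_algebraMap {n : ℕ} (y : KK) (m : ℕ) :
    qPoch (algebraMap KK (KRat n) y) m = algebraMap KK (KRat n) (qPochK y m) := by
  simp [qPoch, qPochK, map_prod]

lemma qPochK_succ' (y : KK) (m : ℕ) :
    qPochK (qK ^ (-(m : ℤ)) * y) (m + 1) =
      qPochK (qK ^ (1 - (m : ℤ)) * y) m * (1 - qK ^ (-(m : ℤ)) * y) := by
  rw [qPochK, qPochK, Finset.prod_range_succ']
  congr 1
  · refine Finset.prod_congr rfl fun j _ => ?_
    rw [show (1 : ℤ) - m = -m + 1 by ring, zpow_add_one₀ qK_ne_zero]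
    ring
  · ring

lemma qPochK_mul (y : KK) (m : ℕ) :
    qPochK (qK ^ (1 - (m : ℤ)) * y) m * (1 - qK ^ (-(m : ℤ)) * y) =
      qPochK (qK ^ (-(m : ℤ)) * y) m * (1 - y) := by
  rw [← qPochK_succ', qPochK, qPochK, Finset.prod_range_succ, ← mul_assoc (qK ^ m),
    ← zpow_natCast, ← zpow_add₀ qK_ne_zero, add_neg_cancel, zpow_zero, one_mul]

/-- The numerator of `A_m(x; v)`. -/
def shiftNum {n : ℕ} (m : ℕ) (v : Fin (n + 1) → ℤ) : KK :=
  ∏ i, qPochK (qK ^ (1 - (m : ℤ)) * (aK * (specPt qK tK v i)⁻¹)) m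

/-- The denominator of `A_m(x; v)`. -/
def shiftDen (n m : ℕ) : KRat n :=
  ∏ i, qPoch (algebraMap KK (KRat n) (qK * tK ^ n) * xvar n i) m

lemma factorA_eq {n : ℕ} (m : ℕ) (v : Fin (n + 1) → ℤ) :
    factorA m v = algebraMap KK (KRat n) (shiftNum m v) * (shiftDen n m)⁻¹ := by
  rw [factorA, Finset.prod_div_distrib, shiftNum, map_prod, shiftDen, div_eq_mul_inv]
  congr 1
  refine Finset.prod_congr rfl fun i _ => ?_
  rw [barK_eq_specPt, qPoch_algebraMap, mul_assoc]

lemma one_sub_mul_xvar_ne_zero {n : ℕ} (c : KK) (i : Fin (n + 1)) :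
    1 - algebraMap KK (KRat n) c * xvar n i ≠ 0 := by
  intro h
  rw [xvar, ← algebraMap_KRat_C, ← map_mul, ← map_one (algebraMap (KPoly n) (KRat n)),
    ← map_sub] at h
  have h1 := IsFractionRing.injective (KPoly n) (KRat n) (h.trans (map_zero _).symm)
  have h2 := congrArg (MvPolynomial.eval fun _ => 0) h1
  simp at h2

lemma qPoch_succ {n : ℕ} (c : KK) (i : Fin (n + 1)) (m : ℕ) :
    qPoch (algebraMap KK (KRat n) c * xvar n i) (m + 1) =
      qPoch (algebraMap KK (KRat n) c * xvar n i) m *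
        (1 - algebraMap KK (KRat n) (qK ^ m * c) * xvar n i) := by
  rw [qPoch, Finset.prod_range_succ, ← qPoch, map_mul, mul_assoc]

lemma shiftNum_succ {n : ℕ} (m : ℕ) (v : Fin (n + 1) → ℤ) :
    shiftNum (m + 1) v = shiftNum m v *
      ∏ i, (1 - qK ^ (-(m : ℤ)) * (aK * (specPt qK tK v i)⁻¹)) := by
  rw [shiftNum, shiftNum, ← Finset.prod_mul_distrib]
  refine Finset.prod_congr rfl fun i _ => ?_
  rw [← qPochK_succ']
  push_cast
  rw [show (1 : ℤ) - (m + 1) = -m by ring]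

lemma shiftDen_succ (n m : ℕ) :
    shiftDen n (m + 1) = shiftDen n m *
      ∏ i, (1 - algebraMap KK (KRat n) (qK ^ m * (qK * tK ^ n)) * xvar n i) := by
  rw [shiftDen, shiftDen, ← Finset.prod_mul_distrib]
  exact Finset.prod_congr rfl fun i _ => qPoch_succ _ i m

lemma shiftedK_eq {n : ℕ} (m : ℕ) (v : Fin (n + 1) → ℤ) :
    shiftedK m v = algebraMap KK (KRat n) (shiftNum m v) * (shiftDen n m)⁻¹ *
      MvPolynomial.aeval (fun i => algebraMap KK (KRat n) (qK ^ m) * xvar n i)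
        (Kint fun i => v i + m) := by
  rw [shiftedK, factorA_eq]
  rfl

/-- Raising m by one adds to A_m one factor per coordinate above and below, and these are the
factors of `aeval_Kint_add_one` at q^m x after cancelling (-t^(1-N))^N. -/
lemma shiftedK_succ {n : ℕ} (m : ℕ) (v : Fin (n + 1) → ℤ) (hv : ∀ i, 0 ≤ v i + m) :
    shiftedK (m + 1) v = shiftedK m v := by
  have ht : tK ≠ 0 := genericParams_KK.t_ne_zero
  have hu : (-tK ^ (-(n : ℤ))) ≠ 0 := neg_ne_zero.2 (zpow_ne_zero _ ht)
  have h := aeval_Kint_add_one (A := KRat n) hv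
    fun i => algebraMap KK (KRat n) (qK ^ m) * xvar n i
  have e1 : (fun i => algebraMap KK (KRat n) qK * (algebraMap KK (KRat n) (qK ^ m) * xvar n i)) =
      fun i => algebraMap KK (KRat n) (qK ^ (m + 1)) * xvar n i := by
    funext i
    rw [pow_succ', map_mul, mul_assoc]
  have e2 : (fun i => v i + (m : ℤ) + 1) = fun i => v i + ((m + 1 : ℕ) : ℤ) := by
    funext i
    push_cast
    ring
  have e3 : ∏ i, (tK ^ (-(n : ℤ)) * (aK * (specPt qK tK (fun i => v i + (m : ℤ)) i)⁻¹ - 1)) =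
      (∏ _i : Fin (n + 1), (-tK ^ (-(n : ℤ)))) *
        ∏ i, (1 - qK ^ (-(m : ℤ)) * (aK * (specPt qK tK v i)⁻¹)) := by
    rw [← Finset.prod_mul_distrib]
    refine Finset.prod_congr rfl fun i _ => ?_
    rw [specPt_add_const qK_ne_zero, mul_inv, ← zpow_neg]
    ring
  have e4 : ∏ i, (algebraMap KK (KRat n) (qK ^ (m + 1)) * xvar n i -
      algebraMap KK (KRat n) (tK ^ (-(n : ℤ)))) =
      algebraMap KK (KRat n) (∏ _i : Fin (n + 1), (-tK ^ (-(n : ℤ)))) *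
        ∏ i, (1 - algebraMap KK (KRat n) (qK ^ m * (qK * tK ^ n)) * xvar n i) := by
    rw [map_prod, ← Finset.prod_mul_distrib]
    refine Finset.prod_congr rfl fun i _ => ?_
    have : qK ^ (m + 1) = tK ^ (-(n : ℤ)) * (qK ^ m * (qK * tK ^ n)) := by
      rw [zpow_neg, zpow_natCast]
      field_simp
      ring
    rw [this, map_mul, map_neg]
    ring
  have e5 : ∀ i, algebraMap KK (KRat n) qK * (algebraMap KK (KRat n) (qK ^ m) * xvar n i) =
      algebraMap KK (KRat n) (qK ^ (m + 1)) * xvar n i := congrFun e1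
  rw [e1, e2, e3] at h
  simp only [e5] at h
  rw [e4, map_mul, mul_assoc, mul_assoc] at h
  have hc : algebraMap KK (KRat n) (∏ _i : Fin (n + 1), (-tK ^ (-(n : ℤ)))) ≠ 0 :=
    (map_ne_zero _).2 (Finset.prod_ne_zero_iff.2 fun _ _ => hu)
  have h' := mul_left_cancel₀ hc h
  have hd : ∏ i, (1 - algebraMap KK (KRat n) (qK ^ m * (qK * tK ^ n)) * xvar n i) ≠ 0 :=
    Finset.prod_ne_zero_iff.2 fun i _ => one_sub_mul_xvar_ne_zero _ i
  have hp := inv_mul_cancel₀ hd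
  rw [shiftedK_eq, shiftedK_eq, shiftNum_succ, shiftDen_succ, map_mul, mul_inv]
  linear_combination (algebraMap KK (KRat n) (shiftNum m v) * (shiftDen n m)⁻¹ *
      (∏ i, (1 - algebraMap KK (KRat n) (qK ^ m * (qK * tK ^ n)) * xvar n i))⁻¹) * h' +
    (algebraMap KK (KRat n) (shiftNum m v) * (shiftDen n m)⁻¹ *
      MvPolynomial.aeval (fun i => algebraMap KK (KRat n) (qK ^ m) * xvar n i)
        (Kint fun i => v i + m)) * hp

lemma minShift_le {n : ℕ} {v : Fin (n + 1) → ℤ} {m : ℕ} (h : ∀ i, 0 ≤ v i + m) :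
    minShift v ≤ m :=
  Finset.sup_le fun i _ => by have := h i; omega

lemma minShift_nonneg {n : ℕ} (v : Fin (n + 1) → ℤ) (i : Fin (n + 1)) : 0 ≤ v i + minShift v := by
  have : (-v i).toNat ≤ minShift v :=
    Finset.le_sup (f := fun i => (-v i).toNat) (Finset.mem_univ i)
  omega

theorem Kext_eq_shiftedK {n : ℕ} (v : Fin (n + 1) → ℤ) (m : ℕ) (h : ∀ i, 0 ≤ v i + m) :
    Kext n v = shiftedK m v := by
  have hm := minShift_le h
  clear h
  induction m, hm using Nat.le_induction with
  | base => rfl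
  | succ m hm ih =>
    rw [ih, shiftedK_succ]
    intro i
    have := minShift_nonneg v i
    omega

theorem Kext_natCast {n : ℕ} (α : Fin (n + 1) → ℕ) :
    Kext n (fun i => (α i : ℤ)) = algebraMap (KPoly n) (KRat n) (Kpoly α) := by
  have h1 : (MvPolynomial.aeval fun i => algebraMap KK (KRat n) (qK ^ 0) * xvar n i) =
      IsScalarTower.toAlgHom KK (KPoly n) (KRat n) := by
    ext i
    simp [xvar]
  have h2 : Kint (fun i => (α i : ℤ) + ((0 : ℕ) : ℤ)) = Kpoly α := by
    simp [Kint]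
  rw [Kext_eq_shiftedK _ 0 (fun i => by simp), shiftedK_eq, h1, h2]
  simp [shiftNum, shiftDen, qPochK, qPoch]

/-! ### The intertwining operators -/

lemma KRat_algHom_ext {n : ℕ} {f g : KRat n →ₐ[KK] KRat n} (h : ∀ i, f (xvar n i) = g (xvar n i)) :
    f = g := by
  refine IsLocalization.algHom_ext (nonZeroDivisors (KPoly n)) ?_
  ext i
  exact h i

/-- The automorphism `f(x) ↦ f(c x)` of `𝕂[x]`. -/
def scalePoly (n : ℕ) (c : KK) (hc : c ≠ 0) : KPoly n ≃ₐ[KK] KPoly n :=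
  AlgEquiv.ofAlgHom (MvPolynomial.aeval fun i => MvPolynomial.C c * MvPolynomial.X i)
    (MvPolynomial.aeval fun i => MvPolynomial.C c⁻¹ * MvPolynomial.X i)
    (by
      ext1 i
      simp [← mul_assoc, ← MvPolynomial.C_mul, MvPolynomial.algebraMap_eq, hc])
    (by
      ext1 i
      simp [← mul_assoc, ← MvPolynomial.C_mul, MvPolynomial.algebraMap_eq, hc])

/-- The automorphism `f(x) ↦ f(q ^ m x)` of `𝕂(x)`. -/
def scaleVars (n m : ℕ) : KRat n ≃ₐ[KK] KRat n :=
  IsFractionRing.fieldEquivOfAlgEquiv KK (KRat n) (KRat n)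
    (scalePoly n (qK ^ m) (pow_ne_zero m qK_ne_zero))

lemma scaleVars_algebraMap {n m : ℕ} (p : KPoly n) :
    scaleVars n m (algebraMap (KPoly n) (KRat n) p) =
      MvPolynomial.aeval (fun i => algebraMap KK (KRat n) (qK ^ m) * xvar n i) p := by
  have : (scaleVars n m).toAlgHom.comp (IsScalarTower.toAlgHom KK (KPoly n) (KRat n)) =
      MvPolynomial.aeval fun i => algebraMap KK (KRat n) (qK ^ m) * xvar n i := by
    ext i
    rw [AlgHom.comp_apply, IsScalarTower.coe_toAlgHom']
    change scaleVars n m (algebraMap (KPoly n) (KRat n) (MvPolynomial.X i)) = _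
    rw [scaleVars, IsFractionRing.fieldEquivOfAlgEquiv_algebraMap, scalePoly,
      AlgEquiv.ofAlgHom_apply, MvPolynomial.aeval_X, map_mul, algebraMap_KRat_C,
      MvPolynomial.aeval_X, xvar]
  exact DFunLike.congr_fun this p

lemma scaleVars_xvar {n m : ℕ} (i : Fin (n + 1)) :
    scaleVars n m (xvar n i) = algebraMap KK (KRat n) (qK ^ m) * xvar n i := by
  rw [xvar, scaleVars_algebraMap, MvPolynomial.aeval_X, xvar]

lemma swapVars_xvar {n : ℕ} (i : Fin n) (j : Fin (n + 1)) :
    swapVars n i (xvar n j) = xvar n (Equiv.swap i.castSucc i.succ j) := by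
  rw [xvar, swapVars_algebraMap, MvPolynomial.rename_X, xvar]

lemma Delta_xvar_zero (n : ℕ) :
    Delta n (xvar n 0) = algebraMap KK (KRat n) qK⁻¹ * xvar n (Fin.last n) := by
  rw [xvar, Delta_algebraMap, deltaPoly, AlgEquiv.ofAlgHom_apply, MvPolynomial.aeval_X,
    Fin.cons_zero, map_mul, algebraMap_KRat_C, xvar]

lemma Delta_xvar_succ {n : ℕ} (i : Fin n) : Delta n (xvar n i.succ) = xvar n i.castSucc := by
  rw [xvar, Delta_algebraMap, deltaPoly, AlgEquiv.ofAlgHom_apply, MvPolynomial.aeval_X,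
    Fin.cons_succ, xvar]

lemma swapVars_scaleVars {n m : ℕ} (i : Fin n) (f : KRat n) :
    swapVars n i (scaleVars n m f) = scaleVars n m (swapVars n i f) := by
  have : (swapVars n i).toAlgHom.comp (scaleVars n m).toAlgHom =
      (scaleVars n m).toAlgHom.comp (swapVars n i).toAlgHom := by
    refine KRat_algHom_ext fun j => ?_
    change swapVars n i (scaleVars n m (xvar n j)) = scaleVars n m (swapVars n i (xvar n j))
    rw [scaleVars_xvar, map_mul, AlgEquiv.commutes, swapVars_xvar, scaleVars_xvar]
  exact DFunLike.congr_fun this f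

lemma Delta_scaleVars {n m : ℕ} (f : KRat n) :
    Delta n (scaleVars n m f) = scaleVars n m (Delta n f) := by
  have : (Delta n).toAlgHom.comp (scaleVars n m).toAlgHom =
      (scaleVars n m).toAlgHom.comp (Delta n).toAlgHom := by
    refine KRat_algHom_ext fun j => ?_
    change Delta n (scaleVars n m (xvar n j)) = scaleVars n m (Delta n (xvar n j))
    rw [scaleVars_xvar, map_mul, AlgEquiv.commutes]
    refine Fin.cases ?_ (fun i => ?_) j
    · rw [Delta_xvar_zero, map_mul, AlgEquiv.commutes, scaleVars_xvar]
      ring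
    · rw [Delta_xvar_succ, scaleVars_xvar]
  exact DFunLike.congr_fun this f

lemma map_qPoch {n : ℕ} (σ : KRat n ≃ₐ[KK] KRat n) (y : KRat n) (m : ℕ) :
    σ (qPoch y m) = qPoch (σ y) m := by
  simp only [qPoch, map_prod, map_sub, map_one, map_mul, AlgEquiv.commutes]

lemma swapVars_shiftDen {n : ℕ} (i : Fin n) (m : ℕ) :
    swapVars n i (shiftDen n m) = shiftDen n m := by
  simp only [shiftDen, map_prod, map_qPoch, map_mul, AlgEquiv.commutes, swapVars_xvar]
  exact Equiv.prod_comp (Equiv.swap i.castSucc i.succ)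
    fun j => qPoch (algebraMap KK (KRat n) qK * algebraMap KK (KRat n) (tK ^ n) * xvar n j) m

/-- Both sides are (c x_i; q)_{m+1}, split off at its first or at its last factor. -/
lemma qPoch_shift {n : ℕ} (c : KK) (i : Fin (n + 1)) (m : ℕ) :
    (1 - algebraMap KK (KRat n) c * xvar n i) *
        qPoch (algebraMap KK (KRat n) (qK * c) * xvar n i) m =
      (1 - algebraMap KK (KRat n) (qK ^ m * c) * xvar n i) *
        qPoch (algebraMap KK (KRat n) c * xvar n i) m := by
  rw [mul_comm (1 - algebraMap KK (KRat n) (qK ^ m * c) * xvar n i), ← qPoch_succ]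
  simp only [qPoch]
  rw [Finset.prod_range_succ', mul_comm]
  simp only [pow_zero, map_one, one_mul]
  congr 1
  refine Finset.prod_congr rfl fun j _ => ?_
  rw [pow_succ]
  simp only [map_mul]
  ring

lemma qPoch_ne_zero {n : ℕ} (c : KK) (i : Fin (n + 1)) (m : ℕ) :
    qPoch (algebraMap KK (KRat n) c * xvar n i) m ≠ 0 := by
  refine Finset.prod_ne_zero_iff.2 fun j _ => ?_
  rw [← mul_assoc, ← map_mul]
  exact one_sub_mul_xvar_ne_zero _ i

lemma shiftDen_ne_zero (n m : ℕ) : shiftDen n m ≠ 0 :=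
  Finset.prod_ne_zero_iff.2 fun i _ => qPoch_ne_zero _ i m

/-- Δ only changes the factor in the last variable, from (q t^(N-1) x_N; q)_m to (t^(N-1) x_N; q)_m.
The discrepancy is exactly what scaling does to x_N - t^(1-N), so Φ commutes with the shift. -/
lemma Delta_shiftDen (n m : ℕ) :
    (xvar n (Fin.last n) - algebraMap KK (KRat n) (tK ^ (-(n : ℤ)))) * shiftDen n m =
      (algebraMap KK (KRat n) (qK ^ m) * xvar n (Fin.last n) -
        algebraMap KK (KRat n) (tK ^ (-(n : ℤ)))) * Delta n (shiftDen n m) := by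
  have h1 : Delta n (shiftDen n m) =
      (∏ i : Fin n, qPoch (algebraMap KK (KRat n) (qK * tK ^ n) * xvar n i.castSucc) m) *
        qPoch (algebraMap KK (KRat n) (tK ^ n) * xvar n (Fin.last n)) m := by
    rw [shiftDen, map_prod, Fin.prod_univ_succ, mul_comm]
    congr 1
    · refine Finset.prod_congr rfl fun i _ => ?_
      rw [map_qPoch, map_mul, AlgEquiv.commutes, Delta_xvar_succ]
    · rw [map_qPoch, map_mul, AlgEquiv.commutes, Delta_xvar_zero, ← mul_assoc, ← map_mul,
        mul_right_comm, mul_inv_cancel₀ qK_ne_zero, one_mul]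
  have hu : ∀ c : KK, algebraMap KK (KRat n) c * xvar n (Fin.last n) -
      algebraMap KK (KRat n) (tK ^ (-(n : ℤ))) = -algebraMap KK (KRat n) (tK ^ (-(n : ℤ))) *
        (1 - algebraMap KK (KRat n) (c * tK ^ n) * xvar n (Fin.last n)) := by
    intro c
    have : algebraMap KK (KRat n) (tK ^ (-(n : ℤ))) * algebraMap KK (KRat n) (tK ^ n) = 1 := by
      rw [← map_mul, zpow_neg, zpow_natCast,
        inv_mul_cancel₀ (pow_ne_zero n genericParams_KK.t_ne_zero), map_one]
    rw [map_mul]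
    linear_combination (-algebraMap KK (KRat n) c * xvar n (Fin.last n)) * this
  have h2 := hu 1
  rw [map_one, one_mul, one_mul] at h2
  rw [h1, hu, h2, shiftDen, Fin.prod_univ_castSucc]
  have h3 := qPoch_shift (tK ^ n) (Fin.last n) m
  linear_combination (-algebraMap KK (KRat n) (tK ^ (-(n : ℤ))) *
    ∏ i : Fin n, qPoch (algebraMap KK (KRat n) (qK * tK ^ n) * xvar n i.castSucc) m) * h3

/-- The operator `f(x) ↦ f(q ^ m x) / ∏_i (q t ^ (N - 1) x_i; q)_m`. -/
def shiftOp (n m : ℕ) : Module.End KK (KRat n) :=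
  mulOp (shiftDen n m)⁻¹ * (scaleVars n m).toLinearMap

lemma shiftOp_apply {n m : ℕ} (f : KRat n) :
    shiftOp n m f = (shiftDen n m)⁻¹ * scaleVars n m f := by
  simp [shiftOp, mulOp]

lemma shiftOp_algebraMap_mul {n m : ℕ} (c : KK) (f : KRat n) :
    shiftOp n m (algebraMap KK (KRat n) c * f) = algebraMap KK (KRat n) c * shiftOp n m f := by
  rw [← Algebra.smul_def, map_smul, Algebra.smul_def]

/-- The denominator is symmetric and the coefficient of H_i is homogeneous of degree 0. -/
lemma HOp_shiftOp {n m : ℕ} (i : Fin n) : Commute (HOp n i) (shiftOp n m) := by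
  refine LinearMap.ext fun f => ?_
  have h : scaleVars n m ((xvar n i.castSucc - algebraMap KK (KRat n) tK * xvar n i.succ) /
      (xvar n i.castSucc - xvar n i.succ)) =
      (xvar n i.castSucc - algebraMap KK (KRat n) tK * xvar n i.succ) /
        (xvar n i.castSucc - xvar n i.succ) := by
    rw [map_div₀, map_sub, map_sub, map_mul, scaleVars_xvar, scaleVars_xvar, AlgEquiv.commutes,
      mul_left_comm (algebraMap KK (KRat n) tK), ← mul_sub, ← mul_sub, mul_div_mul_left]
    exact (map_ne_zero _).2 (pow_ne_zero m qK_ne_zero)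
  rw [Module.End.mul_apply, Module.End.mul_apply, HOp_apply, HOp_apply, shiftOp_apply,
    shiftOp_apply, map_mul, map_inv₀, swapVars_shiftDen, swapVars_scaleVars, map_add, map_mul,
    map_mul, h, AlgEquiv.commutes, map_sub]
  ring

lemma PhiOp_shiftOp {n m : ℕ} : Commute (PhiOp n) (shiftOp n m) := by
  refine LinearMap.ext fun f => ?_
  have h := Delta_shiftDen n m
  have h1 := shiftDen_ne_zero n m
  have h2 : Delta n (shiftDen n m) ≠ 0 := (map_ne_zero _).2 h1
  rw [Module.End.mul_apply, Module.End.mul_apply, PhiOp_apply, PhiOp_apply, shiftOp_apply,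
    shiftOp_apply, map_mul, map_inv₀, Delta_scaleVars, map_mul, map_sub, scaleVars_xvar,
    AlgEquiv.commutes]
  field_simp
  linear_combination scaleVars n m (Delta n f) * h

/-- Only the prefactor x_j⁻¹ fails to commute, and it contributes q^m. This cancels the q^(-m) in
the eigenvalue for v + (m^N). -/
lemma XiOp_shiftOp {n m : ℕ} (j : Fin (n + 1)) (f : KRat n) :
    XiOp n j (shiftOp n m f) = algebraMap KK (KRat n) (qK ^ m) * shiftOp n m (XiOp n j f) := by
  have hlist : ∀ l : List (Fin n), Commute ((l.map (HOp n)).prod) (shiftOp n m) := fun l =>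
    Commute.list_prod_left _ _ fun T hT => by
      obtain ⟨i, -, rfl⟩ := List.mem_map.1 hT
      exact HOp_shiftOp i
  have h : Commute (HFrom n j * PhiOp n * HUpTo n j) (shiftOp n m) :=
    ((hlist _).mul_left PhiOp_shiftOp).mul_left (hlist _)
  have h1 : (HFrom n j * PhiOp n * HUpTo n j) (shiftOp n m f) =
      shiftOp n m ((HFrom n j * PhiOp n * HUpTo n j) f) := DFunLike.congr_fun h.eq f
  have hq : algebraMap KK (KRat n) (qK ^ m) ≠ 0 :=
    (map_ne_zero _).2 (pow_ne_zero m qK_ne_zero)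
  have hx := xvar_ne_zero n j
  rw [XiOp_apply, XiOp_apply, h1, ← map_add, shiftOp_apply, shiftOp_apply, map_mul, map_inv₀,
    scaleVars_xvar]
  field_simp

/-! ### The identities for all integral vectors -/

lemma Kext_eq_shiftOp {n : ℕ} (v : Fin (n + 1) → ℤ) (m : ℕ) (h : ∀ i, 0 ≤ v i + m) :
    Kext n v = algebraMap KK (KRat n) (shiftNum m v) *
      shiftOp n m (algebraMap (KPoly n) (KRat n) (Kint fun i => v i + m)) := by
  rw [Kext_eq_shiftedK v m h, shiftedK_eq, shiftOp_apply, scaleVars_algebraMap, mul_assoc]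

lemma shiftNum_swapEntries {n : ℕ} (i : Fin n) (m : ℕ) (v : Fin (n + 1) → ℤ) :
    shiftNum m (swapEntries i v) = shiftNum m v := by
  by_cases h : v i.castSucc = v i.succ
  · have : swapEntries i v = v := by
      funext j
      rw [swapEntries, Function.comp, Equiv.swap_apply_def]
      split_ifs with h1 h2
      · rw [h1, h]
      · rw [h2, h]
      · rfl
    rw [this]
  · rw [shiftNum, specPt_swapEntries v i h]
    exact Equiv.prod_comp (Equiv.swap i.castSucc i.succ)
      fun j => qPochK (qK ^ (1 - (m : ℤ)) * (aK * (specPt qK tK v j)⁻¹)) m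

/-- Only the factor of v̄_1, replaced by q v̄_1, changes. The ratio converts the Φ-coefficient of v
+ (m^N) into that of v. -/
lemma shiftNum_natVec {n : ℕ} (m : ℕ) (v : Fin (n + 1) → ℤ) :
    shiftNum m v * (1 - qK ^ (-(m : ℤ)) * (aK * (specPt qK tK v 0)⁻¹)) =
      shiftNum m (natVec v) * (1 - aK * (specPt qK tK v 0)⁻¹) := by
  rw [shiftNum, shiftNum, specPt_natVec qK_ne_zero, Fin.prod_univ_succ, Fin.prod_univ_castSucc]
  simp only [rotate, Fin.snoc_castSucc, Fin.snoc_last, Fin.tail]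
  have h := qPochK_mul (aK * (specPt qK tK v 0)⁻¹) m
  have e : qK ^ (1 - (m : ℤ)) * (aK * (qK * specPt qK tK v 0)⁻¹) =
      qK ^ (-(m : ℤ)) * (aK * (specPt qK tK v 0)⁻¹) := by
    rw [sub_eq_neg_add, zpow_add_one₀ qK_ne_zero, mul_inv]
    have := qK_ne_zero
    field_simp
  rw [e]
  linear_combination (∏ i : Fin n,
    qPochK (qK ^ (1 - (m : ℤ)) * (aK * (specPt qK tK v i.succ)⁻¹)) m) * h

lemma heckeCoeff_add_const {n : ℕ} (i : Fin n) (v : Fin (n + 1) → ℤ) (m : ℤ) :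
    heckeCoeff qK tK i (fun j => v j + m) = heckeCoeff qK tK i v := by
  simp only [heckeCoeff, specPt_add_const qK_ne_zero]
  rw [mul_left_comm, ← mul_sub, ← mul_sub, mul_div_mul_left _ _ (zpow_ne_zero _ qK_ne_zero)]

theorem HOp_Kext {n : ℕ} (i : Fin n) (v : Fin (n + 1) → ℤ) :
    HOp n i (Kext n v) = algebraMap KK (KRat n) tK * Kext n v +
      algebraMap KK (KRat n) (heckeCoeff qK tK i v) * (Kext n (swapEntries i v) - Kext n v) := by
  have hm := minShift_nonneg v
  have e : swapEntries i (fun j => v j + (minShift v : ℤ)) =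
      fun j => swapEntries i v j + (minShift v : ℤ) := rfl
  rw [Kext_eq_shiftOp v _ hm, Kext_eq_shiftOp (swapEntries i v) (minShift v) fun j => hm _,
    shiftNum_swapEntries, ← Algebra.smul_def, map_smul, ← Module.End.mul_apply,
    (HOp_shiftOp i).eq, Module.End.mul_apply, HOp_algebraMap, heckePoly_Kint i hm, map_add,
    map_mul, map_mul, algebraMap_KRat_C, algebraMap_KRat_C, map_add, shiftOp_algebraMap_mul,
    shiftOp_algebraMap_mul, heckeCoeff_add_const, e, map_sub]
  simp only [Algebra.smul_def]
  ring

theorem XiOp_Kext {n : ℕ} (j : Fin (n + 1)) (v : Fin (n + 1) → ℤ) :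
    XiOp n j (Kext n v) = algebraMap KK (KRat n) (specPt qK tK v j)⁻¹ * Kext n v := by
  have hm := minShift_nonneg v
  have hq : algebraMap KK (KRat n) (qK ^ minShift v) ≠ 0 :=
    (map_ne_zero _).2 (pow_ne_zero _ qK_ne_zero)
  rw [Kext_eq_shiftOp v _ hm, ← Algebra.smul_def, map_smul, XiOp_shiftOp,
    (hasType_Kint hm).XiOp_apply, shiftOp_algebraMap_mul, specPt_add_const qK_ne_zero,
    zpow_natCast, mul_inv, map_mul, map_inv₀, ← mul_assoc (algebraMap KK (KRat n) (qK ^ _)),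
    mul_inv_cancel_left₀ hq]
  simp only [Algebra.smul_def]
  ring

theorem PhiOp_Kext {n : ℕ} (v : Fin (n + 1) → ℤ) :
    PhiOp n (Kext n v) = algebraMap KK (KRat n) (phiCoeff v) * Kext n (natVec v) := by
  have hm := minShift_nonneg v
  have e : natVec (fun j => v j + (minShift v : ℤ)) =
      fun j => natVec v j + (minShift v : ℤ) := by
    funext i
    refine Fin.lastCases ?_ (fun i => ?_) i
    · simp only [natVec, Fin.snoc_last]
      ring
    · simp [natVec, Fin.tail]
  have hm' : ∀ i, 0 ≤ natVec v i + minShift v := fun i => by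
    have := natVec_nonneg hm i
    rwa [e] at this
  have h : shiftNum (minShift v) v * phiCoeff (fun j => v j + (minShift v : ℤ)) =
      phiCoeff v * shiftNum (minShift v) (natVec v) := by
    rw [phiCoeff, phiCoeff, specPt_add_const qK_ne_zero, mul_inv, ← zpow_neg]
    linear_combination (-tK ^ (-(n : ℤ))) * shiftNum_natVec (minShift v) v
  rw [Kext_eq_shiftOp v _ hm, Kext_eq_shiftOp (natVec v) (minShift v) hm', ← Algebra.smul_def,
    map_smul, ← Module.End.mul_apply, PhiOp_shiftOp.eq, Module.End.mul_apply, PhiOp_algebraMap,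
    phiPoly_Kint hm, map_mul, algebraMap_KRat_C, shiftOp_algebraMap_mul, Algebra.smul_def,
    ← mul_assoc, ← map_mul, h, map_mul, mul_assoc, e]

end

end InterpolationMacdonald

theorem mainTheorem8 (n : ℕ) :
    -- the interpolation polynomials exist, are unique, and can be normalized at `aτ`
    (∀ α : Fin (n + 1) → ℕ, ∃! G, IsInterpolation α G) ∧
    (∀ α : Fin (n + 1) → ℕ, evalG α ≠ 0) ∧
    -- `K_v` does not depend on the shift `m` used to define it
    (∀ (v : Fin (n + 1) → ℤ) (m : ℕ), (∀ i, 0 ≤ v i + m) → Kext n v = shiftedK m v) ∧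
    -- `K_v` extends `K_α`
    (∀ α : Fin (n + 1) → ℕ,
      Kext n (fun i => (α i : ℤ)) = algebraMap (KPoly n) (KRat n) (Kpoly α)) ∧
    -- the three identities
    (∀ i : Fin n, onValues (HOp n i) (Kext n) = hatH n i (Kext n)) ∧
    (∀ j : Fin (n + 1),
      onValues (XiOp n j) (Kext n) = aK • (hatX n j).symm (Kext n)) ∧
    onValues (PhiOp n) (Kext n) =
      tK ^ (-(n : ℤ)) •
        (aK ^ 2 • (hatX n 0).symm ((hatDelta n).symm (Kext n)) - (hatDelta n).symm (Kext n)) := by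
  refine ⟨existsUnique_isInterpolation, evalG_ne_zero, Kext_eq_shiftedK, Kext_natCast,
    fun i => ?_, fun j => ?_, ?_⟩
  · funext v
    change HOp n i (Kext n v) = tK • Kext n v +
      ((barK v i.castSucc - tK * barK v i.succ) / (barK v i.castSucc - barK v i.succ)) •
        (Kext n (swapEntries i v) - Kext n v)
    rw [HOp_Kext, Algebra.smul_def, Algebra.smul_def, barK_eq_specPt, heckeCoeff]
  · funext v
    change XiOp n j (Kext n v) = aK • (aK * barK v j)⁻¹ • Kext n v
    rw [XiOp_Kext, smul_smul, mul_inv, mul_inv_cancel_left₀ aK_ne_zero, Algebra.smul_def,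
      barK_eq_specPt]
  · funext v
    change PhiOp n (Kext n v) = tK ^ (-(n : ℤ)) •
      (aK ^ 2 • (aK * barK v 0)⁻¹ • Kext n (natVec v) - Kext n (natVec v))
    -- The inverse of x̂_1 carries a⁻¹, hence the a² in the third identity.
    have h : aK ^ 2 * (aK * specPt qK tK v 0)⁻¹ = aK * (specPt qK tK v 0)⁻¹ := by
      rw [mul_inv, pow_two, mul_assoc, mul_inv_cancel_left₀ aK_ne_zero]
    rw [PhiOp_Kext, phiCoeff, smul_smul, barK_eq_specPt, h, ← Algebra.smul_def, mul_smul,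
      sub_smul, one_smul]
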